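/- Let $D\subset\mathbb{C}^2$ be a bounded domain with $C^\infty$ boundary: there are an open neighborhood $V$ of $\partial D$ and a real-valued $C^\infty$ function $r$ on $V$ with $V\cap D=\{z\in V: r(z)<0\}$ and $\nabla r\neq 0$ on $V$. Suppose that $D$ is (Levi) pseudoconvex: for every $q\in\partial D$ and every $t\in\mathbb{C}^2$ with $\sum_j \frac{\partial r}{\partial z_j}(q)\,t_j=0$ one has $\sum_{j,k}\frac{\partial^2 r}{\partial z_j\partial\bar z_k}(q)\,t_j\bar t_k\ge 0$. Let $p\in\partial D$, and suppose that $D$ is of type $4$ at $p$, that is, $$\sup_\gamma \frac{\nu(r\circ\gamma)}{\nu(\gamma-p)}=4,$$ where $\gamma$ runs over the germs at $0\in\mathbb{C}$ of nonconstant holomorphic curves in $\mathbb{C}^2$ with $\gamma(0)=p$, and $\nu$ denotes the order of vanishing at $0$. Then $p$ is a local peak point for $A^\omega(D)$: there are an open neighborhood $W$ of $p$ and a function $f$, holomorphic on a neighborhood of $\overline{D\cap W}$, such that $f(p)=1$ and $|f|<1$ on $\overline{D\cap W}\setminus\{p\}$. -/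

import Mathlib

open Filter Topology Asymptotics
open scoped ENNReal ContDiff

namespace SCV

/-- The space `ℂⁿ`. -/
abbrev Cn (n : ℕ) : Type := EuclideanSpace ℂ (Fin n)

variable {n : ℕ}

/-- `r` is a smooth defining function for `D` on the neighborhood `V` of the boundary of `D`. -/
structure IsDefiningFunction (D V : Set (Cn n)) (r : Cn n → ℝ) : Prop where
  isOpen : IsOpen V
  frontier_subset : frontier D ⊆ V
  smooth : ContDiffOn ℝ ∞ r V
  inter_eq : V ∩ D = {z | z ∈ V ∧ r z < 0}
  gradient_ne_zero : ∀ z ∈ V, fderiv ℝ r z ≠ 0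

/-- The Wirtinger derivative `∂f/∂z_j = (∂f/∂x_j - i ∂f/∂y_j) / 2`. -/
noncomputable def dz (j : Fin n) (f : Cn n → ℂ) (x : Cn n) : ℂ :=
  (fderiv ℝ f x (EuclideanSpace.single j 1)
    - Complex.I * fderiv ℝ f x (EuclideanSpace.single j Complex.I)) / 2

/-- The Wirtinger derivative `∂f/∂z̄_j = (∂f/∂x_j + i ∂f/∂y_j) / 2`. -/
noncomputable def dzbar (j : Fin n) (f : Cn n → ℂ) (x : Cn n) : ℂ :=
  (fderiv ℝ f x (EuclideanSpace.single j 1)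
    + Complex.I * fderiv ℝ f x (EuclideanSpace.single j Complex.I)) / 2

/-- `∂r_p(t) = ∑ j, ∂r/∂z_j(p) t_j`. -/
noncomputable def del (r : Cn n → ℝ) (p t : Cn n) : ℂ :=
  ∑ j, dz j (fun x => (r x : ℂ)) p * t j

/-- The Levi form `∑ j k, ∂²r/∂z_j∂z̄_k(p) t_j t̄_k`, a real number when `r` is smooth near `p`. -/
noncomputable def leviForm (r : Cn n → ℝ) (p t : Cn n) : ℂ :=
  ∑ j, ∑ k, dz j (dzbar k (fun x => (r x : ℂ))) p * t j * starRingEnd ℂ (t k)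

/-- Levi pseudoconvexity of `D`, expressed through a defining function `r`: the Levi form is
nonnegative on the complex tangent space at every boundary point. -/
def IsLeviPseudoconvex (D : Set (Cn n)) (r : Cn n → ℝ) : Prop :=
  ∀ p ∈ frontier D, ∀ t : Cn n, del r p t = 0 → 0 ≤ (leviForm r p t).re

/-- The order of vanishing at `0` of a function of one complex variable: the supremum of all `k`
with `f ζ = O(|ζ|^k)` as `ζ → 0`. -/
noncomputable def vanishingOrder {F : Type*} [Norm F] (f : ℂ → F) : ℝ≥0∞ :=
  ⨆ (k : ℕ) (_ : f =O[𝓝 0] fun ζ : ℂ => ‖ζ‖ ^ k), (k : ℝ≥0∞)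

/-- `γ` is (a representative of the germ of) a nonconstant holomorphic curve with `γ 0 = p`. -/
def IsHolomorphicCurveAt (γ : ℂ → Cn n) (p : Cn n) : Prop :=
  AnalyticAt ℂ γ 0 ∧ γ 0 = p ∧ ¬ ∀ᶠ ζ in 𝓝 0, γ ζ = p

/-- The order of contact at `p` of the curve `γ` with the hypersurface `r = 0`: the order of
vanishing of `r ∘ γ` divided by the multiplicity of `γ`. -/
noncomputable def orderOfContact (r : Cn n → ℝ) (p : Cn n) (γ : ℂ → Cn n) : ℝ≥0∞ :=
  vanishingOrder (fun ζ => r (γ ζ)) / vanishingOrder (fun ζ => γ ζ - p)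

/-- The type (in the sense of D'Angelo) at `p` of the hypersurface `r = 0`: the least upper bound
of the orders of contact at `p` of nonconstant holomorphic curves through `p`. -/
noncomputable def dAngeloType (r : Cn n → ℝ) (p : Cn n) : ℝ≥0∞ :=
  ⨆ (γ : ℂ → Cn n) (_ : IsHolomorphicCurveAt γ p), orderOfContact r p γ

/-- `A^ω(D)`: the functions that are holomorphic on a neighborhood of the closure of `D`. -/
def AOmega (D : Set (Cn n)) : Set (Cn n → ℂ) :=
  {f | ∃ U : Set (Cn n), IsOpen U ∧ closure D ⊆ U ∧ DifferentiableOn ℂ f U}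

/-- `p` is a peak point relative to `D` for `A^ω(D)`. -/
def IsPeakPointAOmega (D : Set (Cn n)) (p : Cn n) : Prop :=
  p ∈ frontier D ∧ ∃ f ∈ AOmega D, f p = 1 ∧ ∀ z ∈ closure D \ {p}, ‖f z‖ < 1

/-- `p` is a local peak point for `A^ω(D)`: a peak point for `A^ω(D ∩ V)` for some open
neighborhood `V` of `p`. -/
def IsLocalPeakPointAOmega (D : Set (Cn n)) (p : Cn n) : Prop :=
  p ∈ frontier D ∧ ∃ V : Set (Cn n), IsOpen V ∧ p ∈ V ∧ IsPeakPointAOmega (D ∩ V) p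

end SCV

/-! Near `p` use coordinates `(z, w)` in which `z` runs along the complex tangent direction and `dr`
at `p` is `Re w`. A graph `w = φ(z)`, with `φ` entire and vanishing to second order, is a regular
holomorphic curve through `p`. Adding `c z^k` to `φ` changes the jet of `r` along the graph, up to
order `k`, only by `Re (c z^k)` (`NormalFrame.graphJet_add_monomial`), so pure terms can be
prescribed one order at a time. Mixed terms are controlled by pseudoconvexity: the lowest-order part
of `∂∂̄` of `r` along the graph is nonnegative (`NormalFrame.levi_leading_part_nonneg`).

If the `z z̄` coefficient were positive, the type would be at most 2, so it vanishes. The cubic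
mixed terms vanish because a nonnegative real-linear form is zero. Hence some graph has contact at
least 4 (`NormalFrame.exists_jet_vanishing`). At order 4, with `a` and `b` the jets of bidegrees
`(2,2)` and `(3,1)`, nonnegativity reads `|b| ≤ a`. If `a = 0`, removing the pure quartic term gives
contact 5, which the type excludes. So `a > 0`, and a suitable pure quartic term makes `r ≥ ε|z|⁴`
along a modified graph (`NormalFrame.exists_quartic_lower_bound`).

It remains to leave the graph. `NormalFrame.exists_peak_function` gives an entire `h`, quadratic in
`w - φ(z)` up to a linear twist in `z`, such that `r` is at least its value on the graph plus `κ Re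
h + |w - φ|²` with `κ > 0`, up to an arbitrarily small multiple of `|z|⁴`. Where `r ≤ 0` this forces
`Re h < 0` away from `p`, and `exp h` peaks at `p`. The same `h` with the maximum principle proves
the bound by 2 on the type used above. -/

namespace SCV

/-! ### Wirtinger jets in one variable: Taylor expansion in `z, z̄` and its uniqueness. -/

section OneVariable

/-- The Wirtinger derivative `∂f/∂z` of a function of one complex variable. -/
noncomputable def wz (f : ℂ → ℂ) (z : ℂ) : ℂ :=
  (fderiv ℝ f z 1 - Complex.I * fderiv ℝ f z Complex.I) / 2

/-- The Wirtinger derivative `∂f/∂z̄` of a function of one complex variable. -/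
noncomputable def wzb (f : ℂ → ℂ) (z : ℂ) : ℂ :=
  (fderiv ℝ f z 1 + Complex.I * fderiv ℝ f z Complex.I) / 2

theorem realLinear_apply_eq (L : ℂ →L[ℝ] ℂ) (v : ℂ) :
    L v = (L 1 - Complex.I * L Complex.I) / 2 * v
      + (L 1 + Complex.I * L Complex.I) / 2 * (starRingEnd ℂ) v := by
  have h : L v = v.re * L 1 + v.im * L Complex.I := by
    have hv : v = v.re • (1 : ℂ) + v.im • Complex.I := by
      simp [Complex.re_add_im]
    conv_lhs => rw [hv]
    rw [map_add, map_smul, map_smul]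
    simp
  have h1 : v = v.re + v.im * Complex.I := (Complex.re_add_im v).symm
  have h2 : (starRingEnd ℂ) v = v.re - v.im * Complex.I := by
    apply Complex.ext <;> simp
  rw [h, h2]
  nth_rewrite 3 [h1]
  linear_combination ((v.im : ℂ) * L Complex.I) * Complex.I_sq

theorem wirtinger_of_realLinear (A B : ℂ) (L : ℂ →L[ℝ] ℂ)
    (h : ∀ v, L v = A * v + B * (starRingEnd ℂ) v) :
    (L 1 - Complex.I * L Complex.I) / 2 = A ∧ (L 1 + Complex.I * L Complex.I) / 2 = B := by
  rw [h 1, h Complex.I]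
  simp only [map_one, Complex.conj_I]
  constructor
  · linear_combination (-(A - B) / 2) * Complex.I_sq
  · linear_combination ((A - B) / 2) * Complex.I_sq

theorem fderiv_eq_wirtinger (f : ℂ → ℂ) (z v : ℂ) :
    fderiv ℝ f z v = wz f z * v + wzb f z * (starRingEnd ℂ) v :=
  realLinear_apply_eq _ v

theorem wz_eq_of_fderiv {f : ℂ → ℂ} {z A B : ℂ}
    (h : ∀ v, fderiv ℝ f z v = A * v + B * (starRingEnd ℂ) v) : wz f z = A :=
  (wirtinger_of_realLinear A B _ h).1

theorem wzb_eq_of_fderiv {f : ℂ → ℂ} {z A B : ℂ}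
    (h : ∀ v, fderiv ℝ f z v = A * v + B * (starRingEnd ℂ) v) : wzb f z = B :=
  (wirtinger_of_realLinear A B _ h).2

theorem contDiffAt_fderiv_apply {E F : Type*} [NormedAddCommGroup E] [NormedSpace ℝ E]
    [NormedAddCommGroup F] [NormedSpace ℝ F] {f : E → F} {x : E} (hf : ContDiffAt ℝ ∞ f x)
    (v : E) : ContDiffAt ℝ ∞ (fun y => fderiv ℝ f y v) x :=
  (hf.fderiv_right (m := ∞) (by simp)).clm_apply contDiffAt_const

theorem contDiffAt_wz {f : ℂ → ℂ} {x : ℂ} (hf : ContDiffAt ℝ ∞ f x) : ContDiffAt ℝ ∞ (wz f) x := by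
  unfold wz
  exact ((contDiffAt_fderiv_apply hf _).sub
    (contDiffAt_const.mul (contDiffAt_fderiv_apply hf _))).div_const _

theorem contDiffAt_wzb {f : ℂ → ℂ} {x : ℂ} (hf : ContDiffAt ℝ ∞ f x) :
    ContDiffAt ℝ ∞ (wzb f) x := by
  unfold wzb
  exact ((contDiffAt_fderiv_apply hf _).add
    (contDiffAt_const.mul (contDiffAt_fderiv_apply hf _))).div_const _

theorem wz_congr {f g : ℂ → ℂ} {x : ℂ} (h : f =ᶠ[𝓝 x] g) : wz f =ᶠ[𝓝 x] wz g := by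
  filter_upwards [h.fderiv (𝕜 := ℝ)] with y hy
  simp only [wz, hy]

theorem wzb_congr {f g : ℂ → ℂ} {x : ℂ} (h : f =ᶠ[𝓝 x] g) : wzb f =ᶠ[𝓝 x] wzb g := by
  filter_upwards [h.fderiv (𝕜 := ℝ)] with y hy
  simp only [wzb, hy]

theorem wz_wzb_comm_apply {f : ℂ → ℂ} {x : ℂ} (hf : ContDiffAt ℝ 2 f x) :
    wz (wzb f) x = wzb (wz f) x := by
  have hs : fderiv ℝ (fderiv ℝ f) x 1 Complex.I = fderiv ℝ (fderiv ℝ f) x Complex.I 1 :=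
    (hf.isSymmSndFDerivAt (by simp)) 1 Complex.I
  have hd : DifferentiableAt ℝ (fderiv ℝ f) x :=
    (hf.fderiv_right (m := 1) (by norm_num)).differentiableAt (by simp)
  have hda (v : ℂ) : HasFDerivAt (fun y => fderiv ℝ f y v)
      ((fderiv ℝ (fderiv ℝ f) x).flip v) x := by
    have := hd.hasFDerivAt.clm_apply (hasFDerivAt_const v x)
    simpa using this
  have h1 : HasFDerivAt (wz f) ((2 : ℂ)⁻¹ • ((fderiv ℝ (fderiv ℝ f) x).flip 1 -
      Complex.I • (fderiv ℝ (fderiv ℝ f) x).flip Complex.I)) x := by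
    have := ((hda 1).sub ((hda Complex.I).const_smul Complex.I)).const_smul (2 : ℂ)⁻¹
    refine this.congr_of_eventuallyEq (Eventually.of_forall fun y => ?_)
    simp [wz, div_eq_inv_mul]
  have h2 : HasFDerivAt (wzb f) ((2 : ℂ)⁻¹ • ((fderiv ℝ (fderiv ℝ f) x).flip 1 +
      Complex.I • (fderiv ℝ (fderiv ℝ f) x).flip Complex.I)) x := by
    have := ((hda 1).add ((hda Complex.I).const_smul Complex.I)).const_smul (2 : ℂ)⁻¹
    refine this.congr_of_eventuallyEq (Eventually.of_forall fun y => ?_)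
    simp [wzb, div_eq_inv_mul]
  rw [wz, wzb, h1.fderiv, h2.fderiv]
  simp [hs]
  ring

theorem wz_wzb_comm {f : ℂ → ℂ} {x : ℂ} (hf : ContDiffAt ℝ ∞ f x) :
    wz (wzb f) =ᶠ[𝓝 x] wzb (wz f) := by
  have h2 : ContDiffAt ℝ 2 f x := contDiffAt_infty.1 hf _
  filter_upwards [h2.eventually (by simp)] with y hy
  exact wz_wzb_comm_apply hy

/-- The Wirtinger derivative `∂^i ∂̄^j f (0)`. -/
noncomputable def jet (f : ℂ → ℂ) (i j : ℕ) : ℂ := wz^[i] (wzb^[j] f) 0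

theorem iterate_wz_congr {f g : ℂ → ℂ} {x : ℂ} (h : f =ᶠ[𝓝 x] g) (i : ℕ) :
    wz^[i] f =ᶠ[𝓝 x] wz^[i] g := by
  induction i with
  | zero => exact h
  | succ i ih => simpa only [Function.iterate_succ_apply'] using wz_congr ih

theorem contDiffAt_iterate_wzb {f : ℂ → ℂ} {x : ℂ} (hf : ContDiffAt ℝ ∞ f x) (j : ℕ) :
    ContDiffAt ℝ ∞ (wzb^[j] f) x := by
  induction j with
  | zero => exact hf
  | succ i ih => simpa only [Function.iterate_succ_apply'] using contDiffAt_wzb ih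

theorem iterate_wzb_wz_comm {f : ℂ → ℂ} {x : ℂ} (hf : ContDiffAt ℝ ∞ f x) (j : ℕ) :
    wzb^[j] (wz f) =ᶠ[𝓝 x] wz (wzb^[j] f) := by
  induction j with
  | zero => exact EventuallyEq.rfl
  | succ j ih =>
    simp only [Function.iterate_succ_apply']
    exact (wzb_congr ih).trans (wz_wzb_comm (contDiffAt_iterate_wzb hf j)).symm

theorem jet_wz {f : ℂ → ℂ} (hf : ContDiffAt ℝ ∞ f 0) (i j : ℕ) :
    jet (wz f) i j = jet f (i + 1) j := by
  unfold jet
  rw [Function.iterate_succ_apply]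
  exact (iterate_wz_congr (iterate_wzb_wz_comm hf j) i).eq_of_nhds

theorem jet_wzb (f : ℂ → ℂ) (i j : ℕ) : jet (wzb f) i j = jet f i (j + 1) := rfl

theorem jet_zero_zero (f : ℂ → ℂ) : jet f 0 0 = f 0 := rfl

/-- Mean value inequality on the closed ball of radius `‖z‖`. It drives the induction in
`taylor_isBigO`. -/
theorem isBigO_pow_succ_of_fderiv {E F : Type*} [NormedAddCommGroup E] [NormedSpace ℝ E]
    [NormedAddCommGroup F] [NormedSpace ℝ F] {g : E → F} {k : ℕ}
    (hd : ∀ᶠ z in 𝓝 0, DifferentiableAt ℝ g z) (h0 : g 0 = 0)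
    (hg : fderiv ℝ g =O[𝓝 0] fun z : E => ‖z‖ ^ k) : g =O[𝓝 0] fun z : E => ‖z‖ ^ (k + 1) := by
  obtain ⟨C, hC⟩ := hg.bound
  obtain ⟨δ, hδ, hb⟩ := Metric.eventually_nhds_iff_ball.1 (hd.and hC)
  refine IsBigO.of_bound C ?_
  filter_upwards [Metric.ball_mem_nhds 0 hδ] with z hz
  have hz' : ‖z‖ < δ := by simpa using hz
  have hsub : Metric.closedBall (0 : E) ‖z‖ ⊆ Metric.ball 0 δ :=
    Metric.closedBall_subset_ball hz'
  have hC0 : ∀ x ∈ Metric.closedBall (0 : E) ‖z‖, ‖fderiv ℝ g x‖ ≤ |C| * ‖z‖ ^ k := by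
    intro x hx
    have hx' : ‖x‖ ≤ ‖z‖ := by simpa using hx
    refine ((hb x (hsub hx)).2).trans ?_
    rw [Real.norm_of_nonneg (by positivity)]
    gcongr
    exact le_abs_self C
  have := (convex_closedBall (0 : E) ‖z‖).norm_image_sub_le_of_norm_fderiv_le
    (fun x hx => (hb x (hsub hx)).1) hC0 (x := 0) (y := z) (by simp) (by simp)
  rw [h0, sub_zero, sub_zero] at this
  -- The constant from `IsBigO` has no sign; if it is negative, the derivative bound leaves only the
  -- degenerate case.
  have hCC : 0 ≤ C ∨ ‖z‖ ^ k * ‖z‖ = 0 := by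
    by_contra! hcon
    have h1 := (hb z (hsub (by simp))).2
    rw [Real.norm_of_nonneg (by positivity)] at h1
    have h2 : 0 < ‖z‖ ^ k := by
      rcases (pow_nonneg (norm_nonneg z) k).eq_or_lt with h | h
      · exact absurd (by rw [← h]; ring) hcon.2
      · exact h
    have := norm_nonneg (fderiv ℝ g z)
    nlinarith [hcon.1]
  rw [Real.norm_of_nonneg (by positivity), pow_succ]
  rcases hCC with h | h
  · rw [abs_of_nonneg h] at this
    linarith
  · rw [h]
    linarith [show |C| * ‖z‖ ^ k * ‖z‖ = 0 by rw [mul_assoc, h, mul_zero]]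

/-- The polynomial `∑_{i+j<k} c_{ij} z^i z̄^j / (i! j!)`. -/
noncomputable def bipoly (c : ℕ → ℕ → ℂ) (k : ℕ) (z : ℂ) : ℂ :=
  ∑ i ∈ Finset.range k, ∑ j ∈ Finset.range (k - i),
    c i j / (i.factorial * j.factorial) * z ^ i * (starRingEnd ℂ) z ^ j

theorem hasFDerivAt_conj (z : ℂ) :
    HasFDerivAt (starRingEnd ℂ : ℂ → ℂ) (Complex.conjCLE : ℂ →L[ℝ] ℂ) z :=
  Complex.conjCLE.hasFDerivAt

theorem hasFDerivAt_pow_real (n : ℕ) (z : ℂ) :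
    HasFDerivAt (fun z : ℂ => z ^ n)
      ((((n : ℂ) * z ^ (n - 1)) • (ContinuousLinearMap.id ℝ ℂ)) : ℂ →L[ℝ] ℂ) z := by
  have := (hasDerivAt_pow n z).hasFDerivAt.restrictScalars ℝ
  refine this.congr_fderiv ?_
  ext
  simp [mul_comm]

theorem fderiv_monomial (i j : ℕ) (z : ℂ) :
    HasFDerivAt (fun z : ℂ => z ^ i * (starRingEnd ℂ) z ^ j)
      (((i : ℂ) * z ^ (i - 1) * (starRingEnd ℂ) z ^ j) • (ContinuousLinearMap.id ℝ ℂ) +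
       ((j : ℂ) * z ^ i * (starRingEnd ℂ) z ^ (j - 1)) • (Complex.conjCLE : ℂ →L[ℝ] ℂ)) z := by
  have h1 := hasFDerivAt_pow_real i z
  have h2 := (hasFDerivAt_pow_real j ((starRingEnd ℂ) z)).comp z (hasFDerivAt_conj z)
  have := h1.mul h2
  refine this.congr_fderiv ?_
  ext
  simp
  ring

theorem fderiv_bipoly (c : ℕ → ℕ → ℂ) (k : ℕ) (z : ℂ) :
    HasFDerivAt (bipoly c (k + 1))
      ((bipoly (fun i j => c (i + 1) j) k z) • (ContinuousLinearMap.id ℝ ℂ) +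
       (bipoly (fun i j => c i (j + 1)) k z) • (Complex.conjCLE : ℂ →L[ℝ] ℂ)) z := by
  have h : HasFDerivAt (bipoly c (k + 1)) (∑ i ∈ Finset.range (k + 1),
      ∑ j ∈ Finset.range (k + 1 - i), (c i j / (i.factorial * j.factorial)) •
      (((i : ℂ) * z ^ (i - 1) * (starRingEnd ℂ) z ^ j) • (ContinuousLinearMap.id ℝ ℂ) +
       ((j : ℂ) * z ^ i * (starRingEnd ℂ) z ^ (j - 1)) • (Complex.conjCLE : ℂ →L[ℝ] ℂ))) z := by
    unfold bipoly
    refine HasFDerivAt.fun_sum fun i _ => HasFDerivAt.fun_sum fun j _ => ?_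
    simpa only [mul_assoc] using (fderiv_monomial i j z).const_mul
      (c i j / ((i.factorial : ℂ) * j.factorial))
  refine h.congr_fderiv ?_
  simp only [smul_add, Finset.sum_add_distrib, smul_smul, ← Finset.sum_smul]
  congr 2
  · rw [Finset.sum_range_succ', bipoly]
    simp only [Nat.cast_zero, zero_mul, mul_zero, Finset.sum_const_zero, add_zero,
      Nat.add_sub_add_right, Nat.add_sub_cancel]
    refine Finset.sum_congr rfl fun i _ => Finset.sum_congr rfl fun j _ => ?_
    rw [Nat.factorial_succ]
    have := i.factorial_ne_zero
    have := j.factorial_ne_zero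
    push_cast
    field_simp
  · rw [Finset.sum_range_succ, bipoly]
    simp only [Nat.add_sub_cancel_left, Finset.range_one, Finset.sum_singleton, Nat.cast_zero,
      zero_mul, mul_zero, add_zero]
    refine Finset.sum_congr rfl fun i hi => ?_
    have hi' : k + 1 - i = (k - i) + 1 := by have := Finset.mem_range.1 hi; omega
    rw [hi', Finset.sum_range_succ']
    simp only [Nat.cast_zero, zero_mul, mul_zero, add_zero, Nat.add_sub_cancel]
    refine Finset.sum_congr rfl fun j _ => ?_
    rw [Nat.factorial_succ]
    have := i.factorial_ne_zero
    have := j.factorial_ne_zero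
    push_cast
    field_simp

theorem bipoly_apply_zero (c : ℕ → ℕ → ℂ) (k : ℕ) : bipoly c (k + 1) 0 = c 0 0 := by
  unfold bipoly
  rw [Finset.sum_range_succ', Finset.sum_eq_zero, zero_add, Nat.sub_zero, Finset.sum_range_succ',
    Finset.sum_eq_zero, zero_add]
  · simp
  · intros; simp
  · intros; exact Finset.sum_eq_zero fun _ _ => by simp

/-- Differentiating `bipoly (jet f) (k + 1)` by `z` or `z̄` shifts the coefficients, giving the
order-`k` polynomials of `wz f` and `wzb f`. The induction therefore runs over all `f` at once. -/
theorem taylor_isBigO (k : ℕ) : ∀ f : ℂ → ℂ, ContDiffAt ℝ ∞ f 0 →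
    (fun z => f z - bipoly (jet f) k z) =O[𝓝 0] fun z : ℂ => ‖z‖ ^ k := by
  induction k with
  | zero =>
    intro f hf
    simpa [bipoly] using hf.continuousAt.isBigO_one ℝ
  | succ k ih =>
    intro f hf
    have hf1 : ContDiffAt ℝ 1 f 0 := contDiffAt_infty.1 hf _
    have hd : ∀ᶠ z in 𝓝 (0 : ℂ), DifferentiableAt ℝ f z :=
      (hf1.eventually (by simp)).mono fun z hz => hz.differentiableAt (by simp)
    refine isBigO_pow_succ_of_fderiv ?_ ?_ ?_
    · filter_upwards [hd] with z hz
      exact hz.sub (fderiv_bipoly _ _ _).differentiableAt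
    · simp [bipoly_apply_zero, jet_zero_zero]
    · have h1 := (ih (wz f) (contDiffAt_wz hf)).norm_left.add (ih (wzb f) (contDiffAt_wzb hf)).norm_left
      refine (IsBigO.of_bound 1 ?_).trans h1
      filter_upwards [hd] with z hz
      rw [(hz.hasFDerivAt.fun_sub (fderiv_bipoly (jet f) k z)).fderiv, one_mul]
      have h2 : (fun i j => jet f (i + 1) j) = jet (wz f) := by
        ext i j; exact (jet_wz hf i j).symm
      have h3 : (fun i j => jet f i (j + 1)) = jet (wzb f) := rfl
      rw [h2, h3, Real.norm_of_nonneg (by positivity)]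
      refine ContinuousLinearMap.opNorm_le_bound _ (by positivity) fun v => ?_
      have h4 : (fderiv ℝ f z - (bipoly (jet (wz f)) k z • ContinuousLinearMap.id ℝ ℂ +
          bipoly (jet (wzb f)) k z • (Complex.conjCLE : ℂ →L[ℝ] ℂ))) v =
          (wz f z - bipoly (jet (wz f)) k z) * v +
          (wzb f z - bipoly (jet (wzb f)) k z) * (starRingEnd ℂ) v := by
        simp [fderiv_eq_wirtinger]
        ring
      rw [h4, add_mul]
      refine (norm_add_le _ _).trans_eq ?_
      simp

theorem bipoly_succ (c : ℕ → ℕ → ℂ) (k : ℕ) (z : ℂ) :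
    bipoly c (k + 1) z = bipoly c k z + ∑ i ∈ Finset.range (k + 1),
      c i (k - i) / (i.factorial * (k - i).factorial) * z ^ i * (starRingEnd ℂ) z ^ (k - i) := by
  -- The added term `i = k` is an empty sum.
  have h : bipoly c k z = ∑ i ∈ Finset.range (k + 1), ∑ j ∈ Finset.range (k - i),
      c i j / (i.factorial * j.factorial) * z ^ i * (starRingEnd ℂ) z ^ j := by
    rw [Finset.sum_range_succ]
    simp [bipoly]
  rw [h, ← Finset.sum_add_distrib, bipoly]
  refine Finset.sum_congr rfl fun i hi => ?_
  have hi' : k + 1 - i = (k - i) + 1 := by have := Finset.mem_range.1 hi; omega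
  rw [hi', Finset.sum_range_succ]

/-- A form homogeneous of degree `k` under real scaling that is `O(|z|^(k+1))` vanishes identically.
On the unit circle `z̄ = 1/z`, which turns it into a polynomial with infinitely many roots. -/
theorem coeff_eq_zero_of_isBigO {a : ℕ → ℂ} {k : ℕ}
    (h : (fun z : ℂ => ∑ i ∈ Finset.range (k + 1), a i * z ^ i * (starRingEnd ℂ) z ^ (k - i))
      =O[𝓝 0] fun z : ℂ => ‖z‖ ^ (k + 1)) : ∀ i ≤ k, a i = 0 := by
  set H : ℂ → ℂ := fun z => ∑ i ∈ Finset.range (k + 1), a i * z ^ i * (starRingEnd ℂ) z ^ (k - i)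
    with hH
  have hscale (t : ℝ) (z : ℂ) : H (t * z) = t ^ k * H z := by
    simp only [hH, Finset.mul_sum]
    refine Finset.sum_congr rfl fun i hi => ?_
    have : k = i + (k - i) := by have := Finset.mem_range.1 hi; omega
    rw [map_mul, Complex.conj_ofReal, mul_pow, mul_pow]
    conv_rhs => rw [this, pow_add]
    rw [← this]
    ring
  have hzero (w : ℂ) : H w = 0 := by
    have ht : Tendsto (fun t : ℝ => (t : ℂ) * w) (𝓝[>] 0) (𝓝 0) := by
      have : ContinuousAt (fun t : ℝ => (t : ℂ) * w) 0 := by fun_prop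
      simpa [ContinuousAt] using this.tendsto.mono_left nhdsWithin_le_nhds
    obtain ⟨C, hC⟩ := (h.comp_tendsto ht).bound
    have hle : ∀ᶠ t : ℝ in 𝓝[>] 0, ‖H w‖ ≤ C * ‖w‖ ^ (k + 1) * t := by
      filter_upwards [hC, self_mem_nhdsWithin] with t ht ht0
      have ht0 : 0 < t := ht0
      simp only [Function.comp_apply, hscale, norm_mul, norm_pow, Complex.norm_real,
        norm_norm, Real.norm_of_nonneg ht0.le] at ht
      have : t ^ k * ‖H w‖ ≤ t ^ k * (C * ‖w‖ ^ (k + 1) * t) := by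
        refine ht.trans_eq ?_
        ring
      exact le_of_mul_le_mul_left this (by positivity)
    have hl : Tendsto (fun t : ℝ => C * ‖w‖ ^ (k + 1) * t) (𝓝[>] 0) (𝓝 0) := by
      have : ContinuousAt (fun t : ℝ => C * ‖w‖ ^ (k + 1) * t) 0 := by fun_prop
      simpa [ContinuousAt] using this.tendsto.mono_left nhdsWithin_le_nhds
    exact norm_le_zero_iff.1 (ge_of_tendsto hl hle)
  -- For `|w| = 1`, `w^k * w^i * w̄^(k-i) = w^(2i)`, so `P` agrees there with `w^k H(w)`.
  set P : Polynomial ℂ := ∑ i ∈ Finset.range (k + 1), Polynomial.monomial (2 * i) (a i) with hP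
  have hPz : P = 0 := by
    refine Polynomial.eq_zero_of_infinite_isRoot P (Set.Infinite.mono (s := Metric.sphere 0 1) ?_ ?_)
    · intro w hw
      have hw1 : w * (starRingEnd ℂ) w = 1 := by
        rw [Complex.mul_conj, Complex.normSq_eq_norm_sq]
        simp [mem_sphere_zero_iff_norm.1 hw]
      have : P.eval w = w ^ k * H w := by
        simp only [hP, hH, Polynomial.eval_finsetSum, Polynomial.eval_monomial, Finset.mul_sum]
        refine Finset.sum_congr rfl fun i hi => ?_
        have hk : k = i + (k - i) := by have := Finset.mem_range.1 hi; omega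
        have : w ^ k * (a i * w ^ i * (starRingEnd ℂ) w ^ (k - i)) =
            a i * w ^ (2 * i) * (w * (starRingEnd ℂ) w) ^ (k - i) := by
          nth_rewrite 1 [hk]
          rw [mul_pow, pow_add, two_mul, pow_add]
          ring
        rw [this, hw1, one_pow, mul_one]
      simp [Polynomial.IsRoot, this, hzero]
    · refine (isPreconnected_sphere (by simp) (0 : ℂ) 1).infinite_of_nontrivial
        ⟨1, by simp, -1, by simp, ?_⟩
      norm_num
  intro i hi
  have h1 : P.coeff (2 * i) = a i := by
    simp only [hP, Polynomial.finsetSum_coeff, Polynomial.coeff_monomial]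
    rw [Finset.sum_eq_single i]
    · simp
    · intro b _ hb
      rw [if_neg (by omega)]
    · intro hn
      exact absurd (Finset.mem_range.2 (by omega)) hn
  rw [← h1, hPz, Polynomial.coeff_zero]

theorem homogeneous_isBigO (a : ℕ → ℂ) (k : ℕ) :
    (fun z : ℂ => ∑ i ∈ Finset.range (k + 1), a i * z ^ i * (starRingEnd ℂ) z ^ (k - i))
      =O[𝓝 0] fun z : ℂ => ‖z‖ ^ k := by
  refine IsBigO.fun_sum fun i hi => IsBigO.of_bound ‖a i‖ (Eventually.of_forall fun z => ?_)
  have : k = i + (k - i) := by have := Finset.mem_range.1 hi; omega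
  simp only [norm_mul, norm_pow, RCLike.norm_conj, norm_norm]
  rw [mul_assoc, ← pow_add, ← this]

theorem bipoly_eq_zero {c : ℕ → ℕ → ℂ} {k : ℕ} (h : ∀ i j, i + j < k → c i j = 0) (z : ℂ) :
    bipoly c k z = 0 := by
  refine Finset.sum_eq_zero fun i hi => Finset.sum_eq_zero fun j hj => ?_
  rw [h i j (by have := Finset.mem_range.1 hi; have := Finset.mem_range.1 hj; omega)]
  simp

theorem isBigO_pow_of_le {F : Type*} [Norm F] {f : ℂ → F} {m k : ℕ} (hmk : m ≤ k)
    (h : f =O[𝓝 0] fun z : ℂ => ‖z‖ ^ k) : f =O[𝓝 0] fun z : ℂ => ‖z‖ ^ m := by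
  refine h.trans (IsBigO.of_bound 1 ?_)
  filter_upwards [Metric.closedBall_mem_nhds (0 : ℂ) one_pos] with z hz
  have hz' : ‖z‖ ≤ 1 := by simpa using hz
  simp only [norm_pow, norm_norm, one_mul]
  exact pow_le_pow_of_le_one (norm_nonneg _) hz' hmk

theorem bipoly_coeff_eq_zero (k : ℕ) : ∀ {c : ℕ → ℕ → ℂ},
    (bipoly c k =O[𝓝 0] fun z : ℂ => ‖z‖ ^ k) → ∀ i j, i + j < k → c i j = 0 := by
  induction k with
  | zero => intro c _ i j h; omega
  | succ k ih =>
    intro c h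
    have hs : bipoly c (k + 1) = fun z => bipoly c k z + ∑ i ∈ Finset.range (k + 1),
      c i (k - i) / (i.factorial * (k - i).factorial) * z ^ i * (starRingEnd ℂ) z ^ (k - i) :=
      funext (bipoly_succ c k)
    have hH := homogeneous_isBigO (fun i => c i (k - i) / (i.factorial * (k - i).factorial)) k
    have hlow : bipoly c k =O[𝓝 0] fun z : ℂ => ‖z‖ ^ k := by
      refine ((isBigO_pow_of_le k.le_succ h).sub hH).congr_left fun z => ?_
      rw [bipoly_succ]
      ring
    have h0 := ih hlow
    have htop := coeff_eq_zero_of_isBigO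
      (a := fun i => c i (k - i) / (i.factorial * (k - i).factorial)) (k := k) (by
        refine h.congr_left fun z => ?_
        rw [bipoly_succ, bipoly_eq_zero h0, zero_add])
    intro i j hij
    rcases Nat.lt_succ_iff_lt_or_eq.1 hij with hlt | heq
    · exact h0 i j hlt
    · have := htop i (by omega)
      have hj : k - i = j := by omega
      rw [hj] at this
      have hi0 := i.factorial_ne_zero
      have hj0 := j.factorial_ne_zero
      simpa [hi0, hj0] using this

theorem bipoly_sub (c d : ℕ → ℕ → ℂ) (k : ℕ) (z : ℂ) :
    bipoly (fun i j => c i j - d i j) k z = bipoly c k z - bipoly d k z := by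
  simp only [bipoly, ← Finset.sum_sub_distrib]
  refine Finset.sum_congr rfl fun i _ => Finset.sum_congr rfl fun j _ => ?_
  ring

theorem jet_eq_of_isBigO {f : ℂ → ℂ} (hf : ContDiffAt ℝ ∞ f 0) {c : ℕ → ℕ → ℂ} {k : ℕ}
    (h : (fun z => f z - bipoly c k z) =O[𝓝 0] fun z : ℂ => ‖z‖ ^ k) {i j : ℕ} (hij : i + j < k) :
    jet f i j = c i j := by
  have : bipoly (fun i j => jet f i j - c i j) k =O[𝓝 0] fun z : ℂ => ‖z‖ ^ k := by
    refine (h.sub (taylor_isBigO k f hf)).congr_left fun z => ?_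
    rw [bipoly_sub]
    ring
  exact sub_eq_zero.1 (bipoly_coeff_eq_zero k this i j hij)

theorem bipoly_conj (c : ℕ → ℕ → ℂ) (k : ℕ) (z : ℂ) :
    bipoly (fun i j => (starRingEnd ℂ) (c j i)) k z = (starRingEnd ℂ) (bipoly c k z) := by
  simp only [bipoly, map_sum, map_mul, map_div₀, map_pow, Complex.conj_conj, Complex.conj_natCast]
  rw [Finset.sum_sigma', Finset.sum_sigma']
  refine Finset.sum_nbij' (fun x => ⟨x.2, x.1⟩) (fun x => ⟨x.2, x.1⟩) ?_ ?_ ?_ ?_ ?_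
  · rintro ⟨i, j⟩ h
    simp only [Finset.mem_sigma, Finset.mem_range] at h ⊢
    omega
  · rintro ⟨i, j⟩ h
    simp only [Finset.mem_sigma, Finset.mem_range] at h ⊢
    omega
  · rintro ⟨i, j⟩ _; rfl
  · rintro ⟨i, j⟩ _; rfl
  · rintro ⟨i, j⟩ _
    ring

/-- The conjugate of the Taylor polynomial also approximates a real function, so uniqueness of jets
applies. -/
theorem jet_conj_of_real {f : ℂ → ℝ} (hf : ContDiffAt ℝ ∞ (fun z => (f z : ℂ)) 0) (i j : ℕ) :
    jet (fun z => (f z : ℂ)) i j = (starRingEnd ℂ) (jet (fun z => (f z : ℂ)) j i) := by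
  refine jet_eq_of_isBigO (k := i + j + 1) hf
    (c := fun i j => (starRingEnd ℂ) (jet (fun z => (f z : ℂ)) j i)) ?_ (by omega)
  refine (IsBigO.of_norm_left (f' := fun z => (f z : ℂ) -
    bipoly (fun i j => (starRingEnd ℂ) (jet (fun z => (f z : ℂ)) j i)) (i + j + 1) z) ?_)
  refine (taylor_isBigO (i + j + 1) _ hf).norm_left.congr_left fun z => ?_
  rw [bipoly_conj, ← Complex.norm_conj, map_sub, Complex.conj_ofReal]

end OneVariable

/-! ### The Levi form along holomorphic curves, on and off the boundary. -/

section LeviInequality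

variable {n : ℕ}

theorem fderiv_eq_sum_wirtinger (F : Cn n → ℂ) (x v : Cn n) :
    fderiv ℝ F x v = ∑ j, (dz j F x * v j + dzbar j F x * (starRingEnd ℂ) (v j)) := by
  have hv : v = ∑ j, EuclideanSpace.single j (v j) := by
    ext i
    simp [Finset.sum_apply]
  conv_lhs => rw [hv, map_sum]
  refine Finset.sum_congr rfl fun j _ => ?_
  let S : ℂ →ₗ[ℝ] Cn n :=
    { toFun := fun c => EuclideanSpace.single j c
      map_add' := fun a b => by ext i; by_cases h : i = j <;> simp [h]
      map_smul' := fun a b => by ext i; by_cases h : i = j <;> simp [h] }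
  exact realLinear_apply_eq ((fderiv ℝ F x).comp (LinearMap.toContinuousLinearMap S)) (v j)

theorem contDiffAt_dz {F : Cn n → ℂ} {x : Cn n} (hF : ContDiffAt ℝ ∞ F x) (j : Fin n) :
    ContDiffAt ℝ ∞ (dz j F) x := by
  unfold dz
  exact ((contDiffAt_fderiv_apply hF _).sub
    (contDiffAt_const.mul (contDiffAt_fderiv_apply hF _))).div_const _

theorem contDiffAt_dzbar {F : Cn n → ℂ} {x : Cn n} (hF : ContDiffAt ℝ ∞ F x) (j : Fin n) :
    ContDiffAt ℝ ∞ (dzbar j F) x := by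
  unfold dzbar
  exact ((contDiffAt_fderiv_apply hF _).add
    (contDiffAt_const.mul (contDiffAt_fderiv_apply hF _))).div_const _

theorem contDiffAt_ofReal {E : Type*} [NormedAddCommGroup E] [NormedSpace ℝ E] {r : E → ℝ} {x : E}
    (hr : ContDiffAt ℝ ∞ r x) : ContDiffAt ℝ ∞ (fun y => (r y : ℂ)) x :=
  Complex.ofRealCLM.contDiff.contDiffAt.comp x hr

theorem fderiv_ofReal {E : Type*} [NormedAddCommGroup E] [NormedSpace ℝ E] {r : E → ℝ} {x : E}
    (hr : DifferentiableAt ℝ r x) (v : E) :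
    fderiv ℝ (fun y => (r y : ℂ)) x v = (fderiv ℝ r x v : ℝ) := by
  have : HasFDerivAt (fun y => (r y : ℂ)) (Complex.ofRealCLM.comp (fderiv ℝ r x)) x :=
    Complex.ofRealCLM.hasFDerivAt.comp x hr.hasFDerivAt
  rw [this.fderiv]
  simp

theorem fderiv_eq_two_re_del {r : Cn n → ℝ} {x : Cn n} (hr : DifferentiableAt ℝ r x) (v : Cn n) :
    fderiv ℝ r x v = 2 * (del r x v).re := by
  have h1 := fderiv_eq_sum_wirtinger (fun y => (r y : ℂ)) x v
  have h2 (j : Fin n) : dzbar j (fun y => (r y : ℂ)) x =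
      (starRingEnd ℂ) (dz j (fun y => (r y : ℂ)) x) := by
    simp only [dz, dzbar, fderiv_ofReal hr]
    simp [map_ofNat]
  rw [fderiv_ofReal hr, Finset.sum_add_distrib] at h1
  have h3 := congrArg Complex.re h1
  simp only [h2, ← map_mul, ← map_sum] at h3
  rw [Complex.ofReal_re, Complex.add_re, Complex.conj_re] at h3
  rw [h3, del]
  ring

theorem fderiv_comp_holomorphic {F : Cn n → ℂ} {ψ : ℂ → Cn n} {z : ℂ}
    (hF : DifferentiableAt ℝ F (ψ z)) (hψ : DifferentiableAt ℂ ψ z) (v : ℂ) :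
    fderiv ℝ (fun ζ => F (ψ ζ)) z v =
      (∑ j, dz j F (ψ z) * deriv ψ z j) * v +
      (∑ j, dzbar j F (ψ z) * (starRingEnd ℂ) (deriv ψ z j)) * (starRingEnd ℂ) v := by
  have h1 : HasFDerivAt ψ (((1 : ℂ →L[ℂ] ℂ).smulRight (deriv ψ z)).restrictScalars ℝ) z :=
    hψ.hasDerivAt.hasFDerivAt.restrictScalars ℝ
  have h2 : HasFDerivAt (fun ζ => F (ψ ζ)) _ z := hF.hasFDerivAt.comp z h1
  rw [h2.fderiv]
  simp only [ContinuousLinearMap.comp_apply, fderiv_eq_sum_wirtinger F, Finset.sum_add_distrib,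
    Finset.sum_mul]
  congr 1
  · refine Finset.sum_congr rfl fun j _ => ?_
    simp
    ring
  · refine Finset.sum_congr rfl fun j _ => ?_
    simp
    ring

theorem wz_comp_holomorphic {F : Cn n → ℂ} {ψ : ℂ → Cn n} {z : ℂ}
    (hF : DifferentiableAt ℝ F (ψ z)) (hψ : DifferentiableAt ℂ ψ z) :
    wz (fun ζ => F (ψ ζ)) z = ∑ j, dz j F (ψ z) * deriv ψ z j :=
  wz_eq_of_fderiv (fderiv_comp_holomorphic hF hψ)

theorem wzb_comp_holomorphic {F : Cn n → ℂ} {ψ : ℂ → Cn n} {z : ℂ}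
    (hF : DifferentiableAt ℝ F (ψ z)) (hψ : DifferentiableAt ℂ ψ z) :
    wzb (fun ζ => F (ψ ζ)) z = ∑ j, dzbar j F (ψ z) * (starRingEnd ℂ) (deriv ψ z j) :=
  wzb_eq_of_fderiv (fderiv_comp_holomorphic hF hψ)

theorem hasFDerivAt_conj_comp {g : ℂ → ℂ} {z : ℂ} (hg : DifferentiableAt ℂ g z) :
    HasFDerivAt (fun ζ => (starRingEnd ℂ) (g ζ))
      ((starRingEnd ℂ) (deriv g z) • (Complex.conjCLE : ℂ →L[ℝ] ℂ)) z := by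
  have h1 := hg.hasDerivAt.hasFDerivAt.restrictScalars ℝ
  refine ((hasFDerivAt_conj (g z)).comp z h1).congr_fderiv ?_
  ext v
  simp [mul_comm]

theorem wz_wzb_comp_holomorphic {F : Cn n → ℂ} {ψ : ℂ → Cn n} {z : ℂ}
    (hF : ContDiffAt ℝ ∞ F (ψ z)) (hψ : Differentiable ℂ ψ) :
    wz (wzb (fun ζ => F (ψ ζ))) z =
      ∑ j, ∑ k, dz j (dzbar k F) (ψ z) * deriv ψ z j * (starRingEnd ℂ) (deriv ψ z k) := by
  have hev : ∀ᶠ ζ in 𝓝 z, DifferentiableAt ℝ F (ψ ζ) :=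
    hψ.continuous.continuousAt.eventually (((contDiffAt_infty.1 hF 1).eventually (by simp)).mono
      fun x hx => hx.differentiableAt (by simp))
  have h1 : wzb (fun ζ => F (ψ ζ)) =ᶠ[𝓝 z]
      fun ζ => ∑ k, dzbar k F (ψ ζ) * (starRingEnd ℂ) (deriv ψ ζ k) := by
    filter_upwards [hev] with ζ hζ
    exact wzb_comp_holomorphic hζ (hψ ζ)
  rw [(wz_congr h1).eq_of_nhds]
  have hd (k : Fin n) : DifferentiableAt ℂ (fun ζ => deriv ψ ζ k) z := by
    have h := (hψ.differentiableOn (s := Set.univ)).deriv isOpen_univ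
    have h2 := (h z trivial).differentiableAt univ_mem
    exact (differentiableAt_euclidean.1 h2) k
  have hk (k : Fin n) : DifferentiableAt ℝ (fun ζ => dzbar k F (ψ ζ)) z :=
    ((contDiffAt_dzbar hF k).differentiableAt (by simp)).comp z ((hψ z).restrictScalars ℝ)
  have hsum : HasFDerivAt (fun ζ => ∑ k, dzbar k F (ψ ζ) * (starRingEnd ℂ) (deriv ψ ζ k))
      (∑ k, (dzbar k F (ψ z) • ((starRingEnd ℂ) (deriv (fun ζ => deriv ψ ζ k) z) •
        (Complex.conjCLE : ℂ →L[ℝ] ℂ)) +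
        (starRingEnd ℂ) (deriv ψ z k) • fderiv ℝ (fun ζ => dzbar k F (ψ ζ)) z)) z :=
    HasFDerivAt.fun_sum fun k _ => (hk k).hasFDerivAt.mul (hasFDerivAt_conj_comp (hd k))
  rw [Finset.sum_comm]
  -- The second derivative of `ψ` enters only conjugated, hence only in the coefficient `B` of `v̄`.
  -- The `z`-derivative is the pure Levi expression.
  refine wz_eq_of_fderiv (B := ∑ k, (dzbar k F (ψ z) *
    (starRingEnd ℂ) (deriv (fun ζ => deriv ψ ζ k) z) + (starRingEnd ℂ) (deriv ψ z k) *
      ∑ j, dzbar j (dzbar k F) (ψ z) * (starRingEnd ℂ) (deriv ψ z j))) fun v => ?_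
  rw [hsum.fderiv]
  simp only [sum_apply, add_apply,
    smul_apply, smul_eq_mul, Finset.sum_mul, ← Finset.sum_add_distrib]
  refine Finset.sum_congr rfl fun k _ => ?_
  rw [fderiv_comp_holomorphic ((contDiffAt_dzbar hF k).differentiableAt (by simp)) (hψ z)]
  have : ∑ j, dz j (dzbar k F) (ψ z) * deriv ψ z j * (starRingEnd ℂ) (deriv ψ z k) * v =
      (∑ j, dz j (dzbar k F) (ψ z) * deriv ψ z j) * (starRingEnd ℂ) (deriv ψ z k) * v := by
    rw [Finset.sum_mul, Finset.sum_mul]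
  rw [this]
  simp
  ring

theorem wz_wzb_eq_leviForm {r : Cn n → ℝ} {ψ : ℂ → Cn n} {z : ℂ}
    (hr : ContDiffAt ℝ ∞ r (ψ z)) (hψ : Differentiable ℂ ψ) :
    wz (wzb (fun ζ => (r (ψ ζ) : ℂ))) z = leviForm r (ψ z) (deriv ψ z) := by
  rw [leviForm]
  exact wz_wzb_comp_holomorphic (F := fun x => (r x : ℂ)) (contDiffAt_ofReal hr) hψ

theorem wz_eq_del {r : Cn n → ℝ} {ψ : ℂ → Cn n} {z : ℂ}
    (hr : ContDiffAt ℝ ∞ r (ψ z)) (hψ : Differentiable ℂ ψ) :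
    wz (fun ζ => (r (ψ ζ) : ℂ)) z = del r (ψ z) (deriv ψ z) := by
  rw [del]
  exact wz_comp_holomorphic (F := fun x => (r x : ℂ))
    ((contDiffAt_ofReal hr).differentiableAt (by simp)) (hψ z)

section DefiningFunction

variable {D V : Set (Cn n)} {r : Cn n → ℝ} {p : Cn n}

theorem IsDefiningFunction.contDiffAt (hr : IsDefiningFunction D V r) {x : Cn n} (hx : x ∈ V) :
    ContDiffAt ℝ ∞ r x :=
  hr.smooth.contDiffAt (hr.isOpen.mem_nhds hx)

theorem IsDefiningFunction.mem_iff (hr : IsDefiningFunction D V r) {x : Cn n} (hx : x ∈ V) :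
    x ∈ D ↔ r x < 0 := by
  have := Set.ext_iff.1 hr.inter_eq x
  simpa [hx] using this

theorem IsDefiningFunction.nonpos_of_mem_closure (hr : IsDefiningFunction D V r) {x : Cn n}
    (hx : x ∈ V) (hc : x ∈ closure D) : r x ≤ 0 := by
  by_contra! h
  have h1 : ∀ᶠ y in 𝓝 x, 0 < r y := (hr.contDiffAt hx).continuousAt.eventually (lt_mem_nhds h)
  obtain ⟨y, hyD, hy0, hyV⟩ := ((mem_closure_iff_frequently.1 hc).and_eventually
    (h1.and (hr.isOpen.mem_nhds hx))).exists
  exact absurd ((hr.mem_iff hyV).1 hyD) (not_lt.2 hy0.le)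

theorem IsDefiningFunction.eq_zero_of_mem_frontier (hr : IsDefiningFunction D V r)
    (hD : IsOpen D) {x : Cn n} (hx : x ∈ frontier D) : r x = 0 := by
  have hV := hr.frontier_subset hx
  rw [hD.frontier_eq] at hx
  exact le_antisymm (hr.nonpos_of_mem_closure hV hx.1)
    (not_lt.1 fun h => hx.2 ((hr.mem_iff hV).2 h))

theorem IsDefiningFunction.mem_frontier_of_eq_zero (hr : IsDefiningFunction D V r)
    (hD : IsOpen D) {x : Cn n} (hx : x ∈ V) (h0 : r x = 0) : x ∈ frontier D := by
  rw [hD.frontier_eq]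
  refine ⟨?_, fun h => by have := (hr.mem_iff hx).1 h; linarith⟩
  by_contra hc
  refine hr.gradient_ne_zero x hx (IsLocalMin.fderiv_eq_zero ?_)
  have h1 : ∀ᶠ y in 𝓝 x, y ∈ (closure D)ᶜ := isClosed_closure.isOpen_compl.mem_nhds hc
  filter_upwards [h1, hr.isOpen.mem_nhds hx] with y hy hyV
  rw [h0]
  exact not_lt.1 fun h => hy (subset_closure ((hr.mem_iff hyV).2 h))

/-- Near `p` the derivative of `r` along `v` exceeds `1/2`, so moving by `2|r x|` either way
suffices to cross the zero set. -/
theorem IsDefiningFunction.exists_frontier_near (hr : IsDefiningFunction D V r) (hD : IsOpen D)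
    (hp : p ∈ frontier D) {v : Cn n} (hv : fderiv ℝ r p v = 1) :
    ∀ᶠ x in 𝓝 p, ∃ s : ℝ, |s| ≤ 2 * |r x| ∧ x + s • v ∈ frontier D := by
  have hpV := hr.frontier_subset hp
  have hcd := hr.contDiffAt hpV
  have h1 : ∀ᶠ x in 𝓝 p, 1 / 2 < fderiv ℝ r x v ∧ x ∈ V := by
    refine Eventually.and ?_ (hr.isOpen.mem_nhds hpV)
    exact (contDiffAt_fderiv_apply hcd v).continuousAt.eventually
      (lt_mem_nhds (by simp only [hv]; norm_num))
  obtain ⟨δ, hδ, hball⟩ := Metric.eventually_nhds_iff_ball.1 h1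
  have hsmall : ∀ᶠ x in 𝓝 p, ‖x - p‖ + 2 * |r x| * ‖v‖ < δ := by
    have hc : ContinuousAt (fun x => ‖x - p‖ + 2 * |r x| * ‖v‖) p := by
      have := hcd.continuousAt
      fun_prop
    refine hc.eventually (gt_mem_nhds ?_)
    simpa [hr.eq_zero_of_mem_frontier hD hp] using hδ
  filter_upwards [hsmall] with x hx
  set a := 2 * |r x| with ha
  have ha0 : 0 ≤ a := by positivity
  have hmem : ∀ s ∈ Set.Icc (-a) a, x + s • v ∈ Metric.ball p δ := by
    intro s hs
    rw [mem_ball_iff_norm]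
    have hs' : |s| ≤ a := abs_le.2 hs
    calc ‖x + s • v - p‖ = ‖(x - p) + s • v‖ := by congr 1; abel
      _ ≤ ‖x - p‖ + ‖s • v‖ := norm_add_le _ _
      _ ≤ ‖x - p‖ + a * ‖v‖ := by
        rw [norm_smul, Real.norm_eq_abs]
        gcongr
      _ < δ := hx
  have hder : ∀ s ∈ Set.Icc (-a) a,
      HasDerivAt (fun s : ℝ => r (x + s • v)) (fderiv ℝ r (x + s • v) v) s := by
    intro s hs
    have h2 : HasDerivAt (fun s : ℝ => x + s • v) v s := by
      simpa using ((hasDerivAt_id s).smul_const v).const_add x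
    have h3 := ((hr.contDiffAt (hball _ (hmem s hs)).2).differentiableAt (by simp)).hasFDerivAt
    exact h3.comp_hasDerivAt s h2
  have hcont : ContinuousOn (fun s : ℝ => r (x + s • v)) (Set.Icc (-a) a) :=
    fun s hs => (hder s hs).continuousAt.continuousWithinAt
  have hmono := (convex_Icc (-a) a).mul_sub_le_image_sub_of_le_deriv hcont
    (fun s hs => (hder s (interior_subset hs)).differentiableAt.differentiableWithinAt)
    (C := 1 / 2) (fun s hs => by
      rw [(hder s (interior_subset hs)).deriv]
      exact (hball _ (hmem s (interior_subset hs))).1.le)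
  have h0 : (0 : ℝ) ∈ Set.Icc (-a) a := ⟨by linarith, ha0⟩
  have hup := hmono 0 h0 a ⟨by linarith, le_rfl⟩ ha0
  have hlo := hmono (-a) ⟨le_rfl, by linarith⟩ 0 h0 (by linarith)
  simp only [zero_smul, add_zero] at hup hlo
  have hle := neg_abs_le (r x)
  have hle' := le_abs_self (r x)
  obtain ⟨s, hs, hs0⟩ := intermediate_value_Icc (by linarith) hcont
    (show (0 : ℝ) ∈ Set.Icc (r (x + (-a) • v)) (r (x + a • v)) from
      ⟨by rw [ha] at hlo ⊢; linarith, by rw [ha] at hup ⊢; linarith⟩)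
  exact ⟨s, abs_le.2 hs, hr.mem_frontier_of_eq_zero hD (hball _ (hmem s hs)).2 hs0⟩

theorem contDiffAt_coord {E : Type*} [NormedAddCommGroup E] [NormedSpace ℝ E] {g : E → Cn n}
    {x : E} (hg : ContDiffAt ℝ ∞ g x) (j : Fin n) : ContDiffAt ℝ ∞ (fun y => g y j) x :=
  ((EuclideanSpace.proj (𝕜 := ℂ) j).restrictScalars ℝ).contDiff.contDiffAt.comp x hg

theorem contDiffAt_del {E : Type*} [NormedAddCommGroup E] [NormedSpace ℝ E] {f g : E → Cn n}
    {x : E} (hr : ContDiffAt ℝ ∞ r (f x)) (hf : ContDiffAt ℝ ∞ f x) (hg : ContDiffAt ℝ ∞ g x) :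
    ContDiffAt ℝ ∞ (fun y => del r (f y) (g y)) x := by
  unfold del
  refine ContDiffAt.sum fun j _ => ?_
  exact ((contDiffAt_dz (contDiffAt_ofReal hr) j).comp x hf).mul (contDiffAt_coord hg j)

theorem contDiffAt_leviForm_re {E : Type*} [NormedAddCommGroup E] [NormedSpace ℝ E]
    {f g : E → Cn n} {x : E} (hr : ContDiffAt ℝ ∞ r (f x)) (hf : ContDiffAt ℝ ∞ f x)
    (hg : ContDiffAt ℝ ∞ g x) : ContDiffAt ℝ ∞ (fun y => (leviForm r (f y) (g y)).re) x := by
  unfold leviForm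
  refine Complex.reCLM.contDiff.contDiffAt.comp x ?_
  refine ContDiffAt.sum fun j _ => ContDiffAt.sum fun k _ => ?_
  have hc (k : Fin n) := contDiffAt_coord hg k
  exact ((((contDiffAt_dz (contDiffAt_dzbar (contDiffAt_ofReal hr) k) j).comp x hf).mul
    (hc j))).mul (Complex.conjCLE.contDiff.contDiffAt.comp x (hc k))

theorem exists_lipschitz_of_contDiffAt {E F : Type*} [NormedAddCommGroup E]
    [NormedSpace ℝ E] [NormedAddCommGroup F] [NormedSpace ℝ F] {f : E → F} {x : E}
    (hf : ContDiffAt ℝ ∞ f x) :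
    ∃ C : ℝ, 0 ≤ C ∧ ∃ s ∈ 𝓝 x, ∀ y ∈ s, ∀ z ∈ s, ‖f y - f z‖ ≤ C * ‖y - z‖ := by
  obtain ⟨K, s, hs, hK⟩ := (contDiffAt_infty.1 hf 1).exists_lipschitzOnWith
  exact ⟨K, K.2, s, hs, fun y hy z hz => by
    simpa [dist_eq_norm] using hK.dist_le_mul y hy z hz⟩

theorem del_add_smul (r : Cn n → ℝ) (x t v : Cn n) (c : ℂ) :
    del r x (t + c • v) = del r x t + c * del r x v := by
  simp only [del, Finset.mul_sum, ← Finset.sum_add_distrib]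
  refine Finset.sum_congr rfl fun j _ => ?_
  simp
  ring

/-- Pseudoconvexity speaks only of boundary points and complex tangent vectors. Moving `ψ z` to the
boundary costs `O(|r|)`, and correcting `ψ'(z)` to a tangent vector costs `O(|∂r(ψ')|)`. The Levi
form is locally Lipschitz, so these are the only losses. -/
theorem levi_inequality (hr : IsDefiningFunction D V r) (hD : IsOpen D)
    (hpsc : IsLeviPseudoconvex D r) (hp : p ∈ frontier D) {ψ : ℂ → Cn n}
    (hψ : Differentiable ℂ ψ) (h0 : ψ 0 = p) (ht : del r p (deriv ψ 0) = 0) :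
    ∃ C : ℝ, 0 ≤ C ∧ ∀ᶠ z in 𝓝 0,
      -(C * (|r (ψ z)| + ‖wz (fun ζ => (r (ψ ζ) : ℂ)) z‖)) ≤
        (wz (wzb (fun ζ => (r (ψ ζ) : ℂ))) z).re := by
  have hpV := hr.frontier_subset hp
  have hcd := hr.contDiffAt hpV
  obtain ⟨v, hv⟩ : ∃ v, fderiv ℝ r p v = 1 := by
    obtain ⟨w, hw⟩ : ∃ w, fderiv ℝ r p w ≠ 0 := by
      by_contra! h
      exact hr.gradient_ne_zero p hpV (ContinuousLinearMap.ext h)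
    exact ⟨(fderiv ℝ r p w)⁻¹ • w, by simp [hw]⟩
  have hdv : del r p v ≠ 0 := by
    intro h
    have := fderiv_eq_two_re_del (hcd.differentiableAt (by simp)) v
    rw [hv, h] at this
    norm_num at this
  set T₀ := deriv ψ 0 with hT₀
  have hfst : ContDiffAt ℝ ∞ (fun y : Cn n × Cn n => y.1) (p, T₀) := contDiffAt_fst
  have hsnd : ContDiffAt ℝ ∞ (fun y : Cn n × Cn n => y.2) (p, T₀) := contDiffAt_snd
  -- Chosen so that `y.2 + η y • v` is annihilated by `del r y.1`, wherever `del r y.1 v ≠ 0`.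
  let η : Cn n × Cn n → ℂ := fun y => -(del r y.1 y.2) * (del r y.1 v)⁻¹
  have hη : ContDiffAt ℝ ∞ η (p, T₀) :=
    (contDiffAt_del (r := r) hcd hfst hsnd).neg.mul
      ((contDiffAt_del (r := r) hcd hfst contDiffAt_const).inv hdv)
  have hη0 : η (p, T₀) = 0 := by simp [η, ht]
  let τ : Cn n × Cn n → Cn n := fun y => y.2 + η y • v
  have hτ : ContDiffAt ℝ ∞ τ (p, T₀) := hsnd.add (hη.smul contDiffAt_const)
  let Λ : Cn n × Cn n → ℝ := fun y => (leviForm r y.1 y.2).re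
  have hΛ : ContDiffAt ℝ ∞ Λ (p, T₀) := contDiffAt_leviForm_re (r := r) hcd hfst hsnd
  let Θ : Cn n × Cn n → ℝ := fun y => (leviForm r y.1 (τ y)).re
  have hΘ : ContDiffAt ℝ ∞ Θ (p, T₀) := contDiffAt_leviForm_re (r := r) hcd hfst hτ
  obtain ⟨C₁, hC₁, S₁, hS₁, hL₁⟩ := exists_lipschitz_of_contDiffAt hΛ
  obtain ⟨C₂, hC₂, S₂, hS₂, hL₂⟩ := exists_lipschitz_of_contDiffAt hΘ
  have hdelv : ContinuousAt (fun y => del r y v) p :=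
    (contDiffAt_del (r := r) (f := fun y => y) hcd contDiffAt_id contDiffAt_const).continuousAt
  have hcψ : ContinuousAt ψ 0 := hψ.continuous.continuousAt
  have hcψ' : ContinuousAt (deriv ψ) 0 := by
    have h := (hψ.differentiableOn (s := Set.univ)).deriv isOpen_univ
    exact ((h 0 trivial).differentiableAt univ_mem).continuousAt
  have hpair : Tendsto (fun z => (ψ z, deriv ψ z)) (𝓝 0) (𝓝 (p, T₀)) := by
    have := hcψ.prodMk hcψ'
    simpa [ContinuousAt, h0, hT₀] using this
  have hψp : Tendsto ψ (𝓝 0) (𝓝 p) := by simpa [ContinuousAt, h0] using hcψ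
  have e1 : ∀ᶠ z in 𝓝 (0 : ℂ), (ψ z, deriv ψ z) ∈ S₁ ∩ S₂ :=
    hpair (inter_mem hS₁ hS₂)
  have e2 : ∀ᶠ z in 𝓝 (0 : ℂ), (ψ z, τ (ψ z, deriv ψ z)) ∈ S₁ := by
    have h1 : Tendsto (fun y => (y.1, τ y)) (𝓝 (p, T₀)) (𝓝 (p, T₀)) := by
      have := hfst.continuousAt.prodMk hτ.continuousAt
      simpa [ContinuousAt, τ, hη0] using this
    exact (h1.comp hpair) hS₁
  have e3 : ∀ᶠ z in 𝓝 (0 : ℂ), ‖del r p v‖ / 2 < ‖del r (ψ z) v‖ :=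
    (hdelv.norm.tendsto.comp hψp).eventually (lt_mem_nhds (by simpa using hdv))
  have e4 : ∀ᶠ z in 𝓝 (0 : ℂ), ∀ s : ℝ, |s| ≤ 2 * |r (ψ z)| → (ψ z + s • v, deriv ψ z) ∈ S₂ ∧
      del r (ψ z + s • v) v ≠ 0 := by
    have hgood : ∀ᶠ y in 𝓝 (p, T₀), y ∈ S₂ ∧ del r y.1 v ≠ 0 :=
      Filter.Eventually.and hS₂
        ((hdelv.comp_of_eq hfst.continuousAt rfl).eventually_ne hdv)
    obtain ⟨ε, hε, hball⟩ := Metric.eventually_nhds_iff_ball.1 hgood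
    have h1 : ∀ᶠ x in 𝓝 p, ‖x - p‖ + 2 * |r x| * ‖v‖ < ε := by
      have hc : ContinuousAt (fun x => ‖x - p‖ + 2 * |r x| * ‖v‖) p := by
        have := hcd.continuousAt
        fun_prop
      refine hc.eventually (gt_mem_nhds ?_)
      simpa [hr.eq_zero_of_mem_frontier hD hp] using hε
    filter_upwards [hψp.eventually h1, hcψ'.eventually (Metric.ball_mem_nhds _ hε)] with z z1 z2 s hs
    refine hball (ψ z + s • v, deriv ψ z) (Metric.mem_ball.2 (max_lt ?_ z2))
    rw [dist_eq_norm]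
    calc ‖ψ z + s • v - p‖ = ‖(ψ z - p) + s • v‖ := by congr 1; abel
      _ ≤ ‖ψ z - p‖ + ‖s • v‖ := norm_add_le _ _
      _ ≤ ‖ψ z - p‖ + 2 * |r (ψ z)| * ‖v‖ := by
        rw [norm_smul, Real.norm_eq_abs]
        gcongr
      _ < ε := z1
  have e5 := hψp.eventually (hr.exists_frontier_near hD hp hv)
  have e6 : ∀ᶠ z in 𝓝 (0 : ℂ), ψ z ∈ V := hψp (hr.isOpen.mem_nhds hpV)
  refine ⟨C₂ * 2 * ‖v‖ + C₁ * (2 / ‖del r p v‖) * ‖v‖, by positivity, ?_⟩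
  filter_upwards [e1, e2, e3, e4, e5, e6] with z z1 z2 z3 z4 z5 z6
  obtain ⟨s, hs, hsf⟩ := z5
  have hcz := hr.contDiffAt z6
  rw [wz_wzb_eq_leviForm hcz hψ, wz_eq_del hcz hψ]
  have hΘ0 : 0 ≤ Θ (ψ z + s • v, deriv ψ z) := by
    refine hpsc _ hsf _ ?_
    have := (z4 s hs).2
    simp only [τ, η, del_add_smul]
    field_simp
    ring
  have l2 := hL₂ _ (z4 s hs).1 _ z1.2
  have l1 := hL₁ _ z2 _ z1.1
  have k2 : ‖((ψ z + s • v, deriv ψ z) : Cn n × Cn n) - (ψ z, deriv ψ z)‖ ≤ 2 * |r (ψ z)| * ‖v‖ := by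
    simp only [Prod.mk_sub_mk, add_sub_cancel_left, sub_self, Prod.norm_mk, norm_zero, norm_smul,
      Real.norm_eq_abs]
    rw [max_eq_left (by positivity)]
    gcongr
  have k1 : ‖((ψ z, τ (ψ z, deriv ψ z)) : Cn n × Cn n) - (ψ z, deriv ψ z)‖ ≤
      2 / ‖del r p v‖ * ‖del r (ψ z) (deriv ψ z)‖ * ‖v‖ := by
    simp only [Prod.mk_sub_mk, τ, add_sub_cancel_left, sub_self, Prod.norm_mk, norm_zero, norm_smul]
    rw [max_eq_right (by positivity)]
    gcongr
    simp only [η, ← div_eq_mul_inv, norm_div, norm_neg]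
    have h2 : 0 < ‖del r p v‖ := norm_pos_iff.2 hdv
    rw [div_mul_eq_mul_div, div_le_div_iff₀ (by linarith) h2]
    nlinarith [norm_nonneg (del r (ψ z) (deriv ψ z))]
  have m2 : Θ (ψ z + s • v, deriv ψ z) - Θ (ψ z, deriv ψ z) ≤ C₂ * (2 * |r (ψ z)| * ‖v‖) :=
    (le_abs_self _).trans (l2.trans (by gcongr))
  have m1 : Θ (ψ z, deriv ψ z) - Λ (ψ z, deriv ψ z) ≤
      C₁ * (2 / ‖del r p v‖ * ‖del r (ψ z) (deriv ψ z)‖ * ‖v‖) :=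
    (le_abs_self _).trans (l1.trans (by gcongr))
  have : -(C₂ * (2 * |r (ψ z)| * ‖v‖) +
      C₁ * (2 / ‖del r p v‖ * ‖del r (ψ z) (deriv ψ z)‖ * ‖v‖)) ≤ Λ (ψ z, deriv ψ z) := by
    linarith
  refine le_trans ?_ this
  have p1 : 0 ≤ C₂ * 2 * ‖v‖ * ‖del r (ψ z) (deriv ψ z)‖ := by positivity
  have p2 : 0 ≤ C₁ * (2 / ‖del r p v‖) * ‖v‖ * |r (ψ z)| := by positivity
  linarith

end DefiningFunction

end LeviInequality

/-! ### A holomorphic quadratic polynomial bounding `r` from below off a curve. -/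

section PeakPolynomial

/-- The base point varies too: the expansion is needed uniformly along the curve. -/
theorem second_order_remainder {E : Type*} [NormedAddCommGroup E] [NormedSpace ℝ E] {r : E → ℝ}
    {p : E} (hr : ContDiffAt ℝ ∞ r p) : ∃ C : ℝ, 0 ≤ C ∧ ∀ᶠ y : E × E in 𝓝 (p, 0),
      |r (y.1 + y.2) - r y.1 - fderiv ℝ r y.1 y.2| ≤ C * ‖y.2‖ ^ 2 := by
  obtain ⟨C, hC, S, hS, hL⟩ := exists_lipschitz_of_contDiffAt (hr.fderiv_right (m := ∞) (by simp))
  have hd : ∀ᶠ x in 𝓝 p, DifferentiableAt ℝ r x :=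
    ((contDiffAt_infty.1 hr 1).eventually (by simp)).mono fun x hx => hx.differentiableAt (by simp)
  obtain ⟨δ, hδ, hball⟩ := Metric.eventually_nhds_iff_ball.1 (Filter.Eventually.and hS hd)
  refine ⟨C, hC, ?_⟩
  have h1 : ∀ᶠ y : E × E in 𝓝 (p, 0), y.1 ∈ Metric.ball p δ :=
    continuousAt_fst.eventually (Metric.ball_mem_nhds p hδ)
  have h2 : ∀ᶠ y : E × E in 𝓝 (p, 0), y.1 + y.2 ∈ Metric.ball p δ := by
    have hc : ContinuousAt (fun y : E × E => y.1 + y.2) (p, 0) := by fun_prop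
    exact hc (by simpa using Metric.ball_mem_nhds p hδ)
  filter_upwards [h1, h2] with y y1 y2
  have hseg : segment ℝ y.1 (y.1 + y.2) ⊆ Metric.ball p δ := (convex_ball p δ).segment_subset y1 y2
  have key := (convex_segment y.1 (y.1 + y.2)).norm_image_sub_le_of_norm_fderiv_le' (f := r)
    (C := C * ‖y.2‖) (φ := fderiv ℝ r y.1) (𝕜 := ℝ) (fun x hx => (hball x (hseg hx)).2)
    (fun x hx => by
      refine (hL x (hball x (hseg hx)).1 y.1 (hball _ y1).1).trans ?_
      gcongr
      simpa using norm_sub_le_of_mem_segment hx) (left_mem_segment ℝ y.1 (y.1 + y.2))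
    (right_mem_segment ℝ y.1 (y.1 + y.2))
  rw [add_sub_cancel_left, Real.norm_eq_abs] at key
  rw [pow_two, ← mul_assoc]
  exact key

variable {n : ℕ} {r : Cn n → ℝ} {p v : Cn n} {ψ : ℂ → Cn n}

theorem contDiff_real_of_holomorphic {E : Type*} [NormedAddCommGroup E] [NormedSpace ℂ E]
    [CompleteSpace E] {ψ : ℂ → E} (hψ : Differentiable ℂ ψ) : ContDiff ℝ ∞ ψ :=
  (hψ.contDiff (n := ∞)).restrict_scalars ℝ

theorem expansion_along_curve (hr : ContDiffAt ℝ ∞ r p) (hψ : Differentiable ℂ ψ) (h0 : ψ 0 = p)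
    (hv : ∀ w : ℂ, fderiv ℝ r p (w • v) = w.re) :
    ∃ (α β : ℂ) (C : ℝ), 0 ≤ C ∧ ∀ᶠ y : ℂ × ℂ in 𝓝 0,
      |r (ψ y.1 + y.2 • v) - r (ψ y.1) - (y.2 * (1 + α * y.1 + β * (starRingEnd ℂ) y.1)).re| ≤
        C * (‖y.2‖ ^ 2 + ‖y.2‖ * ‖y.1‖ ^ 2) := by
  set A : ℂ → ℂ := fun z => (fderiv ℝ r (ψ z) v : ℝ) -
    Complex.I * (fderiv ℝ r (ψ z) (Complex.I • v) : ℝ) with hA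
  have hAre (z w : ℂ) : fderiv ℝ r (ψ z) (w • v) = (w * A z).re := by
    have : w • v = w.re • v + w.im • (Complex.I • v) := by
      conv_lhs => rw [← Complex.re_add_im w]
      rw [add_smul, mul_smul, Complex.coe_smul, Complex.coe_smul]
    rw [this, map_add, map_smul, map_smul]
    simp [hA, Complex.mul_re]
  have hA0 : A 0 = 1 := by
    have h1 := hv 1
    have h2 := hv Complex.I
    rw [one_smul] at h1
    simp [hA, h0, h1, h2]
  have hψ0 : ContDiffAt ℝ ∞ ψ 0 := (contDiff_real_of_holomorphic hψ).contDiffAt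
  have hAs : ContDiffAt ℝ ∞ A 0 := by
    have hc (u : Cn n) : ContDiffAt ℝ ∞ (fun z => ((fderiv ℝ r (ψ z) u : ℝ) : ℂ)) 0 := by
      refine contDiffAt_ofReal ?_
      have : ContDiffAt ℝ ∞ (fun x => fderiv ℝ r x u) (ψ 0) := by
        rw [h0]; exact contDiffAt_fderiv_apply hr u
      exact this.comp 0 hψ0
    exact (hc v).sub (contDiffAt_const.mul (hc _))
  obtain ⟨C₁, hC₁⟩ := (taylor_isBigO 2 A hAs).bound
  obtain ⟨C₂, hC₂, hrem⟩ := second_order_remainder hr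
  refine ⟨jet A 1 0, jet A 0 1, |C₁| + C₂ * ‖v‖ ^ 2, by positivity, ?_⟩
  have e1 : ∀ᶠ y : ℂ × ℂ in 𝓝 0, ‖A y.1 - bipoly (jet A) 2 y.1‖ ≤ C₁ * ‖‖y.1‖ ^ 2‖ :=
    (continuousAt_fst (p := ((0 : ℂ), (0 : ℂ)))).eventually hC₁
  have e2 : ∀ᶠ y : ℂ × ℂ in 𝓝 0, |r (ψ y.1 + y.2 • v) - r (ψ y.1) -
      fderiv ℝ r (ψ y.1) (y.2 • v)| ≤ C₂ * ‖y.2 • v‖ ^ 2 := by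
    have hc : ContinuousAt (fun y : ℂ × ℂ => (ψ y.1, y.2 • v)) 0 := by
      have := hψ.continuous
      fun_prop
    refine hc.eventually (p := fun y : Cn n × Cn n =>
      |r (y.1 + y.2) - r y.1 - fderiv ℝ r y.1 y.2| ≤ C₂ * ‖y.2‖ ^ 2) ?_
    simpa [h0] using hrem
  filter_upwards [e1, e2] with y y1 y2
  have hb : bipoly (jet A) 2 y.1 = 1 + jet A 1 0 * y.1 + jet A 0 1 * (starRingEnd ℂ) y.1 := by
    have : jet A 0 0 = 1 := hA0
    simp [bipoly, Finset.sum_range_succ, this]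
    ring
  rw [hb] at y1
  rw [hAre, norm_smul, mul_pow] at y2
  have y3 : |(y.2 * A y.1).re -
      (y.2 * (1 + jet A 1 0 * y.1 + jet A 0 1 * (starRingEnd ℂ) y.1)).re| ≤
      ‖y.2‖ * (|C₁| * ‖y.1‖ ^ 2) := by
    rw [← Complex.sub_re, ← mul_sub]
    refine (Complex.abs_re_le_norm _).trans ?_
    rw [norm_mul]
    gcongr
    refine y1.trans ?_
    rw [Real.norm_of_nonneg (by positivity)]
    gcongr
    exact le_abs_self _
  have := abs_sub_le (r (ψ y.1 + y.2 • v) - r (ψ y.1)) ((y.2 * A y.1).re)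
    ((y.2 * (1 + jet A 1 0 * y.1 + jet A 0 1 * (starRingEnd ℂ) y.1)).re)
  have q1 : 0 ≤ |C₁| * ‖y.2‖ ^ 2 := by positivity
  have q2 : 0 ≤ C₂ * ‖v‖ ^ 2 * (‖y.2‖ * ‖y.1‖ ^ 2) := by positivity
  nlinarith

/-- Since `Re W² = (Re W)² - (Im W)²`, the term `-2K (Re W)²` from the real factor combines with `K
Re W²` to `-K|W|²`. The remaining error is at most half of this. -/
theorem quadratic_correction_le {K s : ℝ} {W : ℂ} (hK : 0 ≤ K) (hs : |s| ≤ 1 / 4)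
    (hW : 2 * K * ‖W‖ ≤ 1 / 4) :
    (1 + s - 2 * K * W.re) * (W + K * W ^ 2).re + K * ‖W‖ ^ 2 / 2 ≤ (1 + s) * W.re := by
  have h1 : (W + K * W ^ 2).re = W.re + K * (W.re ^ 2 - W.im ^ 2) := by
    simp [pow_two, Complex.mul_re]
  have h2 : ‖W‖ ^ 2 = W.re ^ 2 + W.im ^ 2 := by
    rw [← Complex.normSq_eq_norm_sq, Complex.normSq_apply]
    ring
  have h3 : |W.re ^ 2 - W.im ^ 2| ≤ ‖W‖ ^ 2 := by
    rw [h2, abs_le]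
    constructor <;> nlinarith [sq_nonneg W.re, sq_nonneg W.im]
  have h4 : |(s - 2 * K * W.re) * (W.re ^ 2 - W.im ^ 2)| ≤ 1 / 2 * ‖W‖ ^ 2 := by
    rw [abs_mul]
    gcongr
    refine (abs_sub _ _).trans ?_
    rw [abs_mul, abs_of_nonneg (by positivity : 0 ≤ 2 * K)]
    have := mul_le_mul_of_nonneg_left (Complex.abs_re_le_norm W) (by positivity : 0 ≤ 2 * K)
    linarith
  have h5 := mul_le_mul_of_nonneg_left ((le_abs_self _).trans h4) hK
  rw [h1]
  nlinarith

/-- The obstacle is the antiholomorphic term `β z̄` in the coefficient of `w`. Writing `β z̄ = 2 Re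
(β̄ z) - β̄ z` splits it into a real part, absorbed by the positive factor `κ`, and a holomorphic
part, absorbed by `μ`. -/
theorem exists_peak_polynomial (hr : ContDiffAt ℝ ∞ r p) (hψ : Differentiable ℂ ψ) (h0 : ψ 0 = p)
    (hv : ∀ w : ℂ, fderiv ℝ r p (w • v) = w.re) {ε : ℝ} (hε : 0 < ε) :
    ∃ (μ : ℂ) (K : ℝ), ∀ᶠ y : ℂ × ℂ in 𝓝 0, ∃ κ : ℝ, 0 < κ ∧
      r (ψ y.1) + κ * (y.2 * (1 + μ * y.1) + K * (y.2 * (1 + μ * y.1)) ^ 2).re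
        - ε * ‖y.1‖ ^ 4 + ‖y.2‖ ^ 2 ≤ r (ψ y.1 + y.2 • v) := by
  obtain ⟨α, β, C, hC, hexp⟩ := expansion_along_curve hr hψ h0 hv
  set μ : ℂ := α - (starRingEnd ℂ) β with hμ
  set M : ℝ := C + 2 * ‖β‖ * ‖μ‖ with hM
  have hM0 : 0 ≤ M := by positivity
  -- As `|W|² ≥ |w|²/2`, the gain `K|W|²/2` is at least `K|w|²/4`. The three summands pay for the
  -- `|w|²` error, for Young's inequality applied to `|w||z|²`, and for the final `|w|²`.
  set K : ℝ := 4 * (M + M ^ 2 / (4 * ε) + 1) with hK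
  have hK0 : 0 ≤ K := by positivity
  refine ⟨μ, K, ?_⟩
  have e1 : ∀ᶠ y : ℂ × ℂ in 𝓝 0, 2 * K * ‖y.2 * (1 + μ * y.1)‖ < 1 / 4 := by
    have hc : ContinuousAt (fun y : ℂ × ℂ => 2 * K * ‖y.2 * (1 + μ * y.1)‖) 0 := by fun_prop
    exact hc.eventually (gt_mem_nhds (by simp))
  have e2 : ∀ᶠ y : ℂ × ℂ in 𝓝 0, |2 * ((starRingEnd ℂ) β * y.1).re| < 1 / 4 := by
    have hc : ContinuousAt (fun y : ℂ × ℂ => |2 * ((starRingEnd ℂ) β * y.1).re|) 0 := by fun_prop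
    exact hc.eventually (gt_mem_nhds (by simp))
  have e3 : ∀ᶠ y : ℂ × ℂ in 𝓝 0, 1 / 2 < ‖1 + μ * y.1‖ ^ 2 := by
    have hc : ContinuousAt (fun y : ℂ × ℂ => ‖1 + μ * y.1‖ ^ 2) 0 := by fun_prop
    exact hc.eventually (lt_mem_nhds (by norm_num))
  filter_upwards [hexp, e1, e2, e3] with ⟨z, w⟩ h1 h2 h3 h4
  simp only at h1 h2 h3 h4 ⊢
  set s : ℝ := 2 * ((starRingEnd ℂ) β * z).re with hs
  set W : ℂ := w * (1 + μ * z) with hW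
  have hWre : |2 * K * W.re| < 1 / 4 := by
    rw [abs_mul, abs_of_nonneg (by positivity)]
    exact (mul_le_mul_of_nonneg_left (Complex.abs_re_le_norm W) (by positivity)).trans_lt h2
  refine ⟨1 + s - 2 * K * W.re, by linarith [abs_lt.1 h3, abs_lt.1 hWre], ?_⟩
  have hq := quadratic_correction_le hK0 h3.le h2.le
  have hid : (w * (1 + α * z + β * (starRingEnd ℂ) z)).re =
      (1 + s) * W.re - s * (w * μ * z).re := by
    simp only [hs, hW, hμ, Complex.mul_re, Complex.add_re, Complex.sub_re, Complex.add_im,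
      Complex.sub_im, Complex.mul_im, Complex.conj_re, Complex.conj_im, Complex.one_re,
      Complex.one_im]
    ring
  have hse : |s * (w * μ * z).re| ≤ 2 * ‖β‖ * ‖μ‖ * (‖w‖ * ‖z‖ ^ 2) := by
    have a1 : |s| ≤ 2 * (‖β‖ * ‖z‖) := by
      rw [hs, abs_mul, abs_two]
      gcongr
      refine (Complex.abs_re_le_norm _).trans ?_
      simp
    have a2 : |(w * μ * z).re| ≤ ‖w‖ * ‖μ‖ * ‖z‖ := by
      refine (Complex.abs_re_le_norm _).trans ?_
      simp
    rw [abs_mul]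
    refine (mul_le_mul a1 a2 (abs_nonneg _) (by positivity)).trans_eq ?_
    ring
  have hN : ‖w‖ ^ 2 / 2 ≤ ‖W‖ ^ 2 := by
    rw [hW, norm_mul, mul_pow]
    nlinarith [sq_nonneg ‖w‖]
  have hyoung : M * (‖w‖ * ‖z‖ ^ 2) ≤ ε * ‖z‖ ^ 4 + M ^ 2 / (4 * ε) * ‖w‖ ^ 2 := by
    have h := sq_nonneg (2 * ε * ‖z‖ ^ 2 - M * ‖w‖)
    rw [div_mul_eq_mul_div, ← sub_le_iff_le_add', le_div_iff₀ (by positivity)]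
    nlinarith
  have hlow := (abs_le.1 h1).1
  rw [hid] at hlow
  have hse' := (abs_le.1 hse).2
  have hq2 : 0 ≤ 2 * ‖β‖ * ‖μ‖ * ‖w‖ ^ 2 := by positivity
  have hKN : K * (‖w‖ ^ 2 / 2) ≤ K * ‖W‖ ^ 2 := mul_le_mul_of_nonneg_left hN hK0
  have hKe : K * (‖w‖ ^ 2 / 2) / 2 = M * ‖w‖ ^ 2 + M ^ 2 / (4 * ε) * ‖w‖ ^ 2 + ‖w‖ ^ 2 := by
    rw [hK]
    ring
  have hMe : M * (‖w‖ ^ 2 + ‖w‖ * ‖z‖ ^ 2) = C * (‖w‖ ^ 2 + ‖w‖ * ‖z‖ ^ 2) +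
      2 * ‖β‖ * ‖μ‖ * ‖w‖ ^ 2 + 2 * ‖β‖ * ‖μ‖ * (‖w‖ * ‖z‖ ^ 2) := by
    rw [hM]
    ring
  linarith

end PeakPolynomial

/-! ### Orders of contact and bounds on the type. -/

section Contact

section VanishingOrder

variable {F : Type*} [NormedAddCommGroup F] {f : ℂ → F}

theorem le_vanishingOrder {k : ℕ} (h : f =O[𝓝 0] fun ζ : ℂ => ‖ζ‖ ^ k) :
    (k : ℝ≥0∞) ≤ vanishingOrder f :=
  le_iSup₂_of_le (f := fun (k : ℕ) (_ : f =O[𝓝 0] fun ζ : ℂ => ‖ζ‖ ^ k) => (k : ℝ≥0∞)) k h le_rfl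

theorem exists_isBigO_of_lt_vanishingOrder {x : ℝ≥0∞} (h : x < vanishingOrder f) :
    ∃ k : ℕ, x < k ∧ f =O[𝓝 0] fun ζ : ℂ => ‖ζ‖ ^ k := by
  obtain ⟨k, hk⟩ := lt_iSup_iff.1 h
  obtain ⟨hk', hlt⟩ := lt_iSup_iff.1 hk
  exact ⟨k, hlt, hk'⟩

theorem vanishingOrder_le {m : ℕ} {c : ℝ} (hc : 0 < c) (h : ∀ᶠ ζ in 𝓝 (0 : ℂ), c * ‖ζ‖ ^ m ≤ ‖f ζ‖) :
    vanishingOrder f ≤ m := by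
  refine iSup₂_le fun k hk => ?_
  by_contra! hlt
  have hmk : m + 1 ≤ k := by exact_mod_cast hlt
  obtain ⟨C, hC⟩ := (isBigO_pow_of_le hmk hk).bound
  have hsmall : ∀ᶠ ζ in 𝓝 (0 : ℂ), C * ‖ζ‖ < c := by
    have hcont : ContinuousAt (fun ζ : ℂ => C * ‖ζ‖) 0 := by fun_prop
    exact hcont.eventually (gt_mem_nhds (by simpa using hc))
  have hne : ∃ᶠ ζ in 𝓝 (0 : ℂ), ζ ≠ 0 := by
    have : (𝓝[≠] (0 : ℂ)).NeBot := inferInstance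
    exact frequently_iff_neBot.2 this
  obtain ⟨ζ, hζ, h1, h2, h3⟩ := (hne.and_eventually (h.and (hC.and hsmall))).exists
  rw [Real.norm_of_nonneg (by positivity), pow_succ] at h2
  have hpos : 0 < ‖ζ‖ ^ m := pow_pos (norm_pos_iff.2 hζ) m
  nlinarith

end VanishingOrder

variable {n : ℕ} {r : Cn n → ℝ} {p : Cn n}

/-- On a curve of multiplicity `m`, `‖γ - p‖²` has size `|ζ|^(2m)`. If `r ∘ γ` vanished faster, `Re
h` would be negative on the punctured curve, against the maximum principle for `exp (h ∘ γ)`. -/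
theorem orderOfContact_le_two {h : Cn n → ℂ} (hh : Differentiable ℂ h) (hp : h p = 0) {c : ℝ}
    (hc : 0 < c) (hev : ∀ᶠ x in 𝓝 p, ∃ κ : ℝ, 0 < κ ∧ κ * (h x).re + c * ‖x - p‖ ^ 2 ≤ r x)
    {γ : ℂ → Cn n} (hγ : IsHolomorphicCurveAt γ p) : orderOfContact r p γ ≤ 2 := by
  obtain ⟨han, hγ0, hnc⟩ := hγ
  have hsub : AnalyticAt ℂ (fun ζ => γ ζ - p) 0 := han.sub analyticAt_const
  obtain ⟨m, g, hg, hg0, hgeq⟩ := hsub.exists_eventuallyEq_pow_smul_nonzero_iff.2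
    (fun hcon => hnc (hcon.mono fun ζ hζ => sub_eq_zero.1 hζ))
  simp only [sub_zero] at hgeq
  have hm : m ≠ 0 := by
    rintro rfl
    have := hgeq.self_of_nhds
    simp [hγ0] at this
    exact hg0 this.symm
  by_contra! hlt
  have hO : (fun ζ => γ ζ - p) =O[𝓝 0] fun ζ : ℂ => ‖ζ‖ ^ m := by
    have h1 : g =O[𝓝 0] fun _ => (1 : ℝ) := hg.continuousAt.isBigO_one ℝ
    have h2 : (fun ζ : ℂ => ζ ^ m) =O[𝓝 0] fun ζ : ℂ => ‖ζ‖ ^ m :=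
      IsBigO.of_bound 1 (Eventually.of_forall fun ζ => by simp)
    refine (h2.smul h1).congr' (hgeq.mono fun ζ hζ => hζ.symm) ?_
    exact Eventually.of_forall fun ζ => by simp
  have hlow : ∀ᶠ ζ in 𝓝 (0 : ℂ), ‖g 0‖ / 2 * ‖ζ‖ ^ m ≤ ‖γ ζ - p‖ := by
    have h1 : ∀ᶠ ζ in 𝓝 (0 : ℂ), ‖g 0‖ / 2 < ‖g ζ‖ :=
      hg.continuousAt.norm.eventually (lt_mem_nhds (half_lt_self (norm_pos_iff.2 hg0)))
    filter_upwards [h1, hgeq] with ζ h2 h3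
    rw [h3, norm_smul, norm_pow, mul_comm]
    gcongr
  have hν : (2 * m : ℕ) < vanishingOrder (fun ζ => r (γ ζ)) := by
    have h1 : (2 : ℝ≥0∞) < vanishingOrder (fun ζ => r (γ ζ)) / m :=
      hlt.trans_le (ENNReal.div_le_div_left (le_vanishingOrder hO) _)
    have h2 := (ENNReal.lt_div_iff_mul_lt (Or.inl (by exact_mod_cast hm))
      (Or.inl (ENNReal.natCast_ne_top m))).1 h1
    push_cast
    exact h2
  obtain ⟨k, hk, hkO⟩ := exists_isBigO_of_lt_vanishingOrder hν
  have hk' : 2 * m + 1 ≤ k := by exact_mod_cast hk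
  obtain ⟨C, hC⟩ := (isBigO_pow_of_le hk' hkO).bound
  have hneg : ∀ᶠ ζ in 𝓝 (0 : ℂ), ζ ≠ 0 → (h (γ ζ)).re < 0 := by
    have hsmall : ∀ᶠ ζ in 𝓝 (0 : ℂ), C * ‖ζ‖ < c * (‖g 0‖ / 2) ^ 2 := by
      have hcont : ContinuousAt (fun ζ : ℂ => C * ‖ζ‖) 0 := by fun_prop
      have : 0 < c * (‖g 0‖ / 2) ^ 2 := by
        have := norm_pos_iff.2 hg0
        positivity
      exact hcont.eventually (gt_mem_nhds (by simpa using this))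
    have hevγ : ∀ᶠ ζ in 𝓝 (0 : ℂ), ∃ κ : ℝ, 0 < κ ∧
        κ * (h (γ ζ)).re + c * ‖γ ζ - p‖ ^ 2 ≤ r (γ ζ) :=
      han.continuousAt.eventually (by rw [hγ0]; exact hev)
    filter_upwards [hsmall, hevγ, hlow, hC] with ζ h1 h2 h3 h4 hζ
    obtain ⟨κ, hκ, h5⟩ := h2
    have hpos : 0 < ‖ζ‖ ^ (2 * m) := pow_pos (norm_pos_iff.2 hζ) _
    have h6 : (‖g 0‖ / 2) ^ 2 * ‖ζ‖ ^ (2 * m) ≤ ‖γ ζ - p‖ ^ 2 := by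
      have := pow_le_pow_left₀ (by positivity) h3 2
      rwa [mul_pow, ← pow_mul, mul_comm m] at this
    have h7 := mul_le_mul_of_nonneg_left h6 hc.le
    rw [Real.norm_eq_abs, Real.norm_of_nonneg (by positivity), pow_succ] at h4
    have h8 := (le_abs_self _).trans h4
    have h9 := mul_lt_mul_of_pos_right h1 hpos
    by_contra! hcon
    have := mul_nonneg hκ.le hcon
    linarith
  have hmax : IsLocalMax (norm ∘ fun ζ => Complex.exp (h (γ ζ))) 0 := by
    filter_upwards [hneg] with ζ hζ
    simp only [Function.comp_apply, Complex.norm_exp, hγ0, hp, Complex.zero_re, Real.exp_zero]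
    rw [Real.exp_le_one_iff]
    by_cases hz : ζ = 0
    · simp [hz, hγ0, hp]
    · exact (hζ hz).le
  have hdiff : ∀ᶠ ζ in 𝓝 (0 : ℂ), DifferentiableAt ℂ (fun ζ => Complex.exp (h (γ ζ))) ζ :=
    han.eventually_analyticAt.mono fun ζ hζ => ((hh (γ ζ)).comp ζ hζ.differentiableAt).cexp
  have hconst := Complex.eventually_eq_of_isLocalMax_norm hdiff hmax
  have hne : ∃ᶠ ζ in 𝓝 (0 : ℂ), ζ ≠ 0 := by
    have : (𝓝[≠] (0 : ℂ)).NeBot := inferInstance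
    exact frequently_iff_neBot.2 this
  obtain ⟨ζ, hζ, h1, h2⟩ := (hne.and_eventually (hconst.and hneg)).exists
  have h3 := congrArg norm h1
  simp only [Complex.norm_exp, hγ0, hp, Complex.zero_re, Real.exp_zero] at h3
  have := h2 hζ
  rw [Real.exp_eq_one_iff] at h3
  linarith

/-- A regular curve has multiplicity one, so its order of contact is the vanishing order of `r ∘ ψ`.
-/
theorem le_dAngeloType_of_regular_curve {ψ : ℂ → Cn n} (hψ : Differentiable ℂ ψ) (h0 : ψ 0 = p)
    (hd : deriv ψ 0 ≠ 0) {k : ℕ} (hO : (fun ζ => r (ψ ζ)) =O[𝓝 0] fun ζ : ℂ => ‖ζ‖ ^ k) :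
    (k : ℝ≥0∞) ≤ dAngeloType r p := by
  have hlow : ∀ᶠ ζ in 𝓝 (0 : ℂ), ‖deriv ψ 0‖ / 2 * ‖ζ‖ ^ 1 ≤ ‖ψ ζ - p‖ := by
    have hlo := (hasDerivAt_iff_isLittleO.1 (hψ 0).hasDerivAt).bound
      (half_pos (norm_pos_iff.2 hd))
    filter_upwards [hlo] with ζ hζ
    rw [sub_zero, h0] at hζ
    have h1 := norm_sub_norm_le (ζ • deriv ψ 0) (ψ ζ - p)
    rw [norm_sub_rev (ζ • deriv ψ 0), norm_smul] at h1
    rw [pow_one]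
    linarith
  have hcurve : IsHolomorphicCurveAt ψ p := by
    refine ⟨hψ.analyticAt 0, h0, fun hcon => hd ?_⟩
    have : ψ =ᶠ[𝓝 0] fun _ => p := hcon
    rw [this.deriv_eq, deriv_const]
  have hle := vanishingOrder_le (half_pos (norm_pos_iff.2 hd)) hlow
  refine le_trans ?_ (le_iSup₂_of_le (f := fun (γ : ℂ → Cn n) (_ : IsHolomorphicCurveAt γ p) =>
    orderOfContact r p γ) ψ hcurve le_rfl)
  calc (k : ℝ≥0∞) = k / 1 := by simp
    _ ≤ vanishingOrder (fun ζ => r (ψ ζ)) / vanishingOrder (fun ζ => ψ ζ - p) :=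
      ENNReal.div_le_div (le_vanishingOrder hO) (by simpa using hle)

end Contact

/-! ### Adapted coordinates and graphs over the complex tangent line. -/

section NormalForm

/-- A frame `t, v` of `ℂⁿ` with coordinates `ℓ, w`, where `t` is a complex tangent vector of the
hypersurface `r = 0` at `p` and the differential of `r` at `p` is `Re w`. -/
structure NormalFrame {n : ℕ} (r : Cn n → ℝ) (p t v : Cn n) (ℓ w : Cn n →L[ℂ] ℂ) : Prop where
  tangent_ne_zero : t ≠ 0
  del_tangent : del r p t = 0
  fderiv_normal : ∀ c : ℂ, fderiv ℝ r p (c • v) = c.re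
  coord : ∀ x, x = ℓ x • t + w x • v

theorem exists_normalFrame {r : Cn 2 → ℝ} {p : Cn 2} (hr : DifferentiableAt ℝ r p)
    (hd : fderiv ℝ r p ≠ 0) : ∃ t v ℓ w, NormalFrame r p t v ℓ w := by
  set a := dz 0 (fun x => (r x : ℂ)) p with ha
  set b := dz 1 (fun x => (r x : ℂ)) p with hb
  have hdel (x : Cn 2) : del r p x = a * x 0 + b * x 1 := by
    simp [del, Fin.sum_univ_two, ha, hb]
  have hab : a ≠ 0 ∨ b ≠ 0 := by
    by_contra! h
    refine hd (ContinuousLinearMap.ext fun x => ?_)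
    rw [fderiv_eq_two_re_del hr, hdel, h.1, h.2]
    simp
  set N : ℂ := a * (starRingEnd ℂ) a + b * (starRingEnd ℂ) b with hN
  have hN0 : N ≠ 0 := by
    have h1 : N = ((Complex.normSq a + Complex.normSq b : ℝ) : ℂ) := by
      rw [hN, Complex.mul_conj, Complex.mul_conj]
      push_cast
      rfl
    rw [h1, Complex.ofReal_ne_zero]
    have h2 := Complex.normSq_nonneg a
    have h3 := Complex.normSq_nonneg b
    rcases hab with h | h
    · have := Complex.normSq_pos.2 h
      linarith
    · have := Complex.normSq_pos.2 h
      linarith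
  let P (j : Fin 2) : Cn 2 →L[ℂ] ℂ := EuclideanSpace.proj j
  -- The factor 2 offsets `dr = 2 Re ∂r`.
  refine ⟨!₂[-b, a], (2 * N)⁻¹ • !₂[(starRingEnd ℂ) a, (starRingEnd ℂ) b],
    N⁻¹ • ((starRingEnd ℂ) a • P 1 - (starRingEnd ℂ) b • P 0), (2 : ℂ) • (a • P 0 + b • P 1),
    ?_, ?_, ?_, ?_⟩
  · intro h
    have h0 := congrArg (fun x : Cn 2 => x 0) h
    have h1 := congrArg (fun x : Cn 2 => x 1) h
    simp at h0 h1
    tauto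
  · rw [hdel]
    simp
    ring
  · intro c
    have h : del r p (c • (2 * N)⁻¹ • !₂[(starRingEnd ℂ) a, (starRingEnd ℂ) b]) = c / 2 := by
      rw [hdel]
      simp only [PiLp.smul_apply, smul_eq_mul, Matrix.cons_val_zero, Matrix.cons_val_one]
      field_simp
      rw [hN]
    rw [fderiv_eq_two_re_del hr, h]
    simp
    ring
  · intro x
    ext j
    fin_cases j
    · simp [P]
      field_simp
      rw [hN]
      ring
    · simp [P]
      field_simp
      rw [hN]
      ring

/-- The graph of `φ` over the tangent direction `t`, as a holomorphic curve through `p`. -/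
noncomputable def graphCurve {n : ℕ} (p t v : Cn n) (φ : ℂ → ℂ) (z : ℂ) : Cn n :=
  p + z • t + φ z • v

/-- Entire functions vanishing to second order at `0`. -/
structure VanishesToSecondOrder (φ : ℂ → ℂ) : Prop where
  differentiable : Differentiable ℂ φ
  apply_zero : φ 0 = 0
  deriv_zero : deriv φ 0 = 0

theorem VanishesToSecondOrder.add_monomial {φ : ℂ → ℂ} (hφ : VanishesToSecondOrder φ) (c : ℂ)
    {k : ℕ} (hk : 2 ≤ k) : VanishesToSecondOrder (fun z => φ z + c * z ^ k) := by
  have hd := hφ.differentiable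
  refine ⟨by fun_prop, ?_, ?_⟩
  · simp [hφ.apply_zero, show k ≠ 0 by omega]
  · have h : HasDerivAt (fun z => φ z + c * z ^ k) (deriv φ 0 + c * (k * 0 ^ (k - 1))) 0 :=
      (hd 0).hasDerivAt.add ((hasDerivAt_pow k (0 : ℂ)).const_mul c)
    rw [h.deriv, hφ.deriv_zero, zero_pow (by omega)]
    simp

section

variable {n : ℕ} {r : Cn n → ℝ} {p t v : Cn n} {ℓ w : Cn n →L[ℂ] ℂ} {φ : ℂ → ℂ}

theorem VanishesToSecondOrder.graphCurve_differentiable (hφ : VanishesToSecondOrder φ) :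
    Differentiable ℂ (graphCurve p t v φ) := by
  have hd := hφ.differentiable
  unfold graphCurve
  fun_prop

theorem VanishesToSecondOrder.graphCurve_zero (hφ : VanishesToSecondOrder φ) :
    graphCurve p t v φ 0 = p := by
  simp [graphCurve, hφ.apply_zero]

theorem VanishesToSecondOrder.deriv_graphCurve (hφ : VanishesToSecondOrder φ) :
    deriv (graphCurve p t v φ) 0 = t := by
  have h1 : HasDerivAt (fun z : ℂ => p + z • t) ((1 : ℂ) • t) 0 :=
    ((hasDerivAt_id (0 : ℂ)).smul_const t).const_add p
  have h2 : HasDerivAt (fun z : ℂ => φ z • v) (deriv φ 0 • v) 0 :=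
    (hφ.differentiable 0).hasDerivAt.smul_const v
  have h : HasDerivAt (graphCurve p t v φ) ((1 : ℂ) • t + deriv φ 0 • v) 0 := h1.add h2
  rw [h.deriv, hφ.deriv_zero, one_smul, zero_smul, add_zero]

/-- The jets at `0` of `r` along the graph of `φ`. -/
noncomputable def graphJet (r : Cn n → ℝ) (p t v : Cn n) (φ : ℂ → ℂ) : ℕ → ℕ → ℂ :=
  jet (fun z => (r (graphCurve p t v φ z) : ℂ))

theorem contDiffAt_along_graph (hr : ContDiffAt ℝ ∞ r p) (hφ : VanishesToSecondOrder φ) :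
    ContDiffAt ℝ ∞ (fun z => (r (graphCurve p t v φ z) : ℂ)) 0 := by
  refine contDiffAt_ofReal ?_
  refine ContDiffAt.comp (g := r) 0 ?_
    (contDiff_real_of_holomorphic hφ.graphCurve_differentiable).contDiffAt
  rwa [hφ.graphCurve_zero]

theorem graphJet_conj (hr : ContDiffAt ℝ ∞ r p) (hφ : VanishesToSecondOrder φ) (i j : ℕ) :
    graphJet r p t v φ i j = (starRingEnd ℂ) (graphJet r p t v φ j i) :=
  jet_conj_of_real (contDiffAt_along_graph hr hφ) i j

/-- The jets of `Re (c z^k)` of total order at most `k`. -/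
noncomputable def pureJet (c : ℂ) (k i j : ℕ) : ℂ :=
  if i = k ∧ j = 0 then k.factorial * c / 2
  else if i = 0 ∧ j = k then k.factorial * (starRingEnd ℂ) c / 2 else 0

theorem bipoly_pureJet (c : ℂ) {k : ℕ} (hk : 1 ≤ k) (z : ℂ) :
    bipoly (pureJet c k) (k + 1) z = ((c * z ^ k).re : ℂ) := by
  have h0 : ∀ i j, i + j < k → pureJet c k i j = 0 := by
    intro i j hij
    rw [pureJet, if_neg (by omega), if_neg (by omega)]
  rw [bipoly_succ, bipoly_eq_zero h0, zero_add, Finset.sum_range_succ]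
  obtain ⟨k, rfl⟩ : ∃ m, k = m + 1 := ⟨k - 1, by omega⟩
  rw [Finset.sum_range_succ', Finset.sum_eq_zero, zero_add]
  · have hf : ((k + 1).factorial : ℂ) ≠ 0 := by exact_mod_cast (k + 1).factorial_ne_zero
    have hre : ((c * z ^ (k + 1)).re : ℂ) =
        (c * z ^ (k + 1) + (starRingEnd ℂ) c * (starRingEnd ℂ) z ^ (k + 1)) / 2 := by
      rw [Complex.re_eq_add_conj, map_mul, map_pow]
    rw [hre]
    simp only [pureJet, Nat.sub_self, Nat.sub_zero, and_self, if_true, Nat.factorial_zero,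
      Nat.cast_one, mul_one, one_mul, pow_zero]
    rw [if_neg (by omega)]
    field_simp
    ring
  · intro i hi
    have := Finset.mem_range.1 hi
    rw [pureJet, if_neg (by omega), if_neg (by omega)]
    simp

theorem bipoly_add (c d : ℕ → ℕ → ℂ) (k : ℕ) (z : ℂ) :
    bipoly (fun i j => c i j + d i j) k z = bipoly c k z + bipoly d k z := by
  simp only [bipoly, ← Finset.sum_add_distrib]
  refine Finset.sum_congr rfl fun i _ => Finset.sum_congr rfl fun j _ => ?_
  ring

/-- In `expansion_along_curve` with increment `c z^k`, every term but `Re (c z^k)` has order at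
least `k + 1`; for the quadratic one, `2k ≥ k + 1`. -/
theorem NormalFrame.graphJet_add_monomial (hF : NormalFrame r p t v ℓ w) (hr : ContDiffAt ℝ ∞ r p)
    (hφ : VanishesToSecondOrder φ) (c : ℂ) {k : ℕ} (hk : 2 ≤ k) {i j : ℕ} (hij : i + j ≤ k) :
    graphJet r p t v (fun z => φ z + c * z ^ k) i j = graphJet r p t v φ i j + pureJet c k i j := by
  refine jet_eq_of_isBigO (k := k + 1) (contDiffAt_along_graph hr (hφ.add_monomial c hk))
    (c := fun i j => graphJet r p t v φ i j + pureJet c k i j) ?_ (by omega)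
  obtain ⟨α, β, C, hC, hexp⟩ := expansion_along_curve hr
    (hφ.graphCurve_differentiable (p := p) (t := t) (v := v)) hφ.graphCurve_zero hF.fderiv_normal
  have htend : Tendsto (fun z : ℂ => (z, c * z ^ k)) (𝓝 0) (𝓝 0) := by
    have hc : ContinuousAt (fun z : ℂ => (z, c * z ^ k)) 0 := by fun_prop
    simpa [ContinuousAt, show k ≠ 0 by omega, ← Prod.mk_zero_zero] using hc
  have hmain : (fun z => ((r (graphCurve p t v (fun z => φ z + c * z ^ k) z) -
      r (graphCurve p t v φ z) - (c * z ^ k).re : ℝ) : ℂ)) =O[𝓝 0] fun z : ℂ => ‖z‖ ^ (k + 1) := by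
    refine IsBigO.of_bound (C * (‖c‖ ^ 2 + ‖c‖) + ‖c‖ * (‖α‖ + ‖β‖)) ?_
    filter_upwards [htend.eventually hexp, Metric.closedBall_mem_nhds (0 : ℂ) one_pos] with z hz hz1
    have hz1 : ‖z‖ ≤ 1 := by simpa using hz1
    have hcurve : graphCurve p t v (fun z => φ z + c * z ^ k) z =
        graphCurve p t v φ z + (c * z ^ k) • v := by
      simp only [graphCurve, add_smul, add_assoc]
    rw [hcurve, Complex.norm_real, Real.norm_eq_abs, Real.norm_of_nonneg (by positivity)]
    have hsplit : (c * z ^ k * (1 + α * z + β * (starRingEnd ℂ) z)).re =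
        (c * z ^ k).re + (c * z ^ k * (α * z + β * (starRingEnd ℂ) z)).re := by
      rw [← Complex.add_re]
      congr 1
      ring
    have h1 : |(c * z ^ k * (α * z + β * (starRingEnd ℂ) z)).re| ≤
        ‖c‖ * (‖α‖ + ‖β‖) * ‖z‖ ^ (k + 1) := by
      refine (Complex.abs_re_le_norm _).trans ?_
      rw [norm_mul, norm_mul, norm_pow]
      have : ‖α * z + β * (starRingEnd ℂ) z‖ ≤ (‖α‖ + ‖β‖) * ‖z‖ := by
        refine (norm_add_le _ _).trans_eq ?_
        simp
        ring
      calc ‖c‖ * ‖z‖ ^ k * ‖α * z + β * (starRingEnd ℂ) z‖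
          ≤ ‖c‖ * ‖z‖ ^ k * ((‖α‖ + ‖β‖) * ‖z‖) := by gcongr
        _ = _ := by ring
    have h2 : ‖c * z ^ k‖ ^ 2 + ‖c * z ^ k‖ * ‖z‖ ^ 2 ≤ (‖c‖ ^ 2 + ‖c‖) * ‖z‖ ^ (k + 1) := by
      rw [norm_mul, norm_pow]
      have e1 : ‖z‖ ^ (2 * k) ≤ ‖z‖ ^ (k + 1) :=
        pow_le_pow_of_le_one (norm_nonneg _) hz1 (by omega)
      have e2 : ‖z‖ ^ (k + 2) ≤ ‖z‖ ^ (k + 1) :=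
        pow_le_pow_of_le_one (norm_nonneg _) hz1 (by omega)
      calc (‖c‖ * ‖z‖ ^ k) ^ 2 + ‖c‖ * ‖z‖ ^ k * ‖z‖ ^ 2
          = ‖c‖ ^ 2 * ‖z‖ ^ (2 * k) + ‖c‖ * ‖z‖ ^ (k + 2) := by ring
        _ ≤ ‖c‖ ^ 2 * ‖z‖ ^ (k + 1) + ‖c‖ * ‖z‖ ^ (k + 1) := by gcongr
        _ = _ := by ring
    have h3 := mul_le_mul_of_nonneg_left h2 hC
    rw [hsplit] at hz
    have h4 := abs_le.1 (hz.trans h3)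
    have h5 := abs_le.1 h1
    rw [abs_le]
    constructor <;> linarith [h4.1, h4.2, h5.1, h5.2]
  refine (hmain.add (taylor_isBigO (k + 1) _
    (contDiffAt_along_graph (t := t) (v := v) hr hφ))).congr_left fun z => ?_
  rw [bipoly_add, bipoly_pureJet c (by omega)]
  simp only [graphJet]
  push_cast
  ring

theorem NormalFrame.exists_peak_function (hF : NormalFrame r p t v ℓ w) (hr : ContDiffAt ℝ ∞ r p)
    (hφ : VanishesToSecondOrder φ) {ε : ℝ} (hε : 0 < ε) :
    ∃ h : Cn n → ℂ, Differentiable ℂ h ∧ h p = 0 ∧ ∀ᶠ x in 𝓝 p, ∃ κ : ℝ, 0 < κ ∧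
      r (graphCurve p t v φ (ℓ (x - p))) + κ * (h x).re - ε * ‖ℓ (x - p)‖ ^ 4
        + ‖w (x - p) - φ (ℓ (x - p))‖ ^ 2 ≤ r x := by
  obtain ⟨μ, K, hev⟩ := exists_peak_polynomial hr
    (hφ.graphCurve_differentiable (p := p) (t := t) (v := v)) hφ.graphCurve_zero hF.fderiv_normal hε
  have hd := hφ.differentiable
  refine ⟨fun x => (w (x - p) - φ (ℓ (x - p))) * (1 + μ * ℓ (x - p)) +
    K * ((w (x - p) - φ (ℓ (x - p))) * (1 + μ * ℓ (x - p))) ^ 2, by fun_prop, ?_, ?_⟩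
  · simp [hφ.apply_zero]
  · have hc : Tendsto (fun x => (ℓ (x - p), w (x - p) - φ (ℓ (x - p)))) (𝓝 p) (𝓝 0) := by
      have hcont : Continuous (fun x => (ℓ (x - p), w (x - p) - φ (ℓ (x - p)))) := by
        have := hd.continuous
        fun_prop
      simpa [hφ.apply_zero, ← Prod.mk_zero_zero] using hcont.continuousAt (x := p).tendsto
    filter_upwards [hc.eventually hev] with x hx
    obtain ⟨κ, hκ, hle⟩ := hx
    refine ⟨κ, hκ, hle.trans_eq ?_⟩
    congr 1
    have := hF.coord (x - p)
    simp only [graphCurve, sub_smul]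
    calc p + ℓ (x - p) • t + φ (ℓ (x - p)) • v + (w (x - p) • v - φ (ℓ (x - p)) • v)
        = p + (ℓ (x - p) • t + w (x - p) • v) := by abel
      _ = p + (x - p) := by rw [← this]
      _ = x := by abel

end

end NormalForm

/-! ### Leading terms along a graph: consequences of pseudoconvexity and of the type. -/

section LeadingTerms

theorem homogeneous_nonneg {g : ℂ → ℝ} {k : ℕ} (hg : ∀ (s : ℝ) (z : ℂ), g (s * z) = s ^ k * g z)
    {C : ℝ} (h : ∀ᶠ z in 𝓝 0, -(C * ‖z‖ ^ (k + 1)) ≤ g z) (z : ℂ) : 0 ≤ g z := by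
  have ht : Tendsto (fun s : ℝ => (s : ℂ) * z) (𝓝[>] 0) (𝓝 0) := by
    have : ContinuousAt (fun s : ℝ => (s : ℂ) * z) 0 := by fun_prop
    simpa [ContinuousAt] using this.tendsto.mono_left nhdsWithin_le_nhds
  have hle : ∀ᶠ s : ℝ in 𝓝[>] 0, -(C * ‖z‖ ^ (k + 1) * s) ≤ g z := by
    filter_upwards [ht.eventually h, self_mem_nhdsWithin] with s hs hs0
    have hs0 : 0 < s := hs0
    rw [hg, norm_mul, Complex.norm_real, Real.norm_of_nonneg hs0.le] at hs
    have : s ^ k * -(C * ‖z‖ ^ (k + 1) * s) ≤ s ^ k * g z := by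
      refine le_trans (le_of_eq ?_) hs
      ring
    exact le_of_mul_le_mul_left this (by positivity)
  have hl : Tendsto (fun s : ℝ => -(C * ‖z‖ ^ (k + 1) * s)) (𝓝[>] 0) (𝓝 0) := by
    have : ContinuousAt (fun s : ℝ => -(C * ‖z‖ ^ (k + 1) * s)) 0 := by fun_prop
    simpa [ContinuousAt] using this.tendsto.mono_left nhdsWithin_le_nhds
  exact le_of_tendsto hl hle

theorem bipoly_smul {c : ℕ → ℕ → ℂ} {k : ℕ} (hc : ∀ i j, i + j < k → c i j = 0) (s : ℝ) (z : ℂ) :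
    bipoly c (k + 1) (s * z) = s ^ k * bipoly c (k + 1) z := by
  rw [bipoly_succ, bipoly_succ, bipoly_eq_zero hc, bipoly_eq_zero hc, zero_add, zero_add,
    Finset.mul_sum]
  refine Finset.sum_congr rfl fun i hi => ?_
  have hk : k = i + (k - i) := by have := Finset.mem_range.1 hi; omega
  rw [map_mul, Complex.conj_ofReal, mul_pow, mul_pow]
  conv_rhs => rw [hk, pow_add, ← hk]
  ring

theorem isBigO_of_jet_eq_zero {f : ℂ → ℂ} (hf : ContDiffAt ℝ ∞ f 0) {k : ℕ}
    (h : ∀ i j, i + j < k → jet f i j = 0) : f =O[𝓝 0] fun z : ℂ => ‖z‖ ^ k :=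
  (taylor_isBigO k f hf).congr_left fun z => by rw [bipoly_eq_zero h, sub_zero]

section

variable {n : ℕ} {D V : Set (Cn n)} {r : Cn n → ℝ} {p t v : Cn n} {ℓ w : Cn n →L[ℂ] ℂ} {φ : ℂ → ℂ}

theorem NormalFrame.graphJet_low (hF : NormalFrame r p t v ℓ w) (hr : ContDiffAt ℝ ∞ r p)
    (h0 : r p = 0) (hφ : VanishesToSecondOrder φ) {i j : ℕ} (hij : i + j < 2) :
    graphJet r p t v φ i j = 0 := by
  have h00 : graphJet r p t v φ 0 0 = 0 := by
    rw [graphJet, jet_zero_zero, hφ.graphCurve_zero, h0, Complex.ofReal_zero]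
  have h10 : graphJet r p t v φ 1 0 = 0 := by
    have hr' : ContDiffAt ℝ ∞ r (graphCurve p t v φ 0) := by rwa [hφ.graphCurve_zero]
    have h := wz_eq_del hr' hφ.graphCurve_differentiable
    rw [hφ.graphCurve_zero, hφ.deriv_graphCurve, hF.del_tangent] at h
    exact h
  have h01 : graphJet r p t v φ 0 1 = 0 := by
    rw [graphJet_conj hr hφ, h10, map_zero]
  obtain ⟨rfl, rfl⟩ | ⟨rfl, rfl⟩ | ⟨rfl, rfl⟩ : (i = 0 ∧ j = 0) ∨ (i = 1 ∧ j = 0) ∨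
    (i = 0 ∧ j = 1) := by omega
  exacts [h00, h10, h01]

/-- Along the graph `r` is of order `k + 2` and `∂r` of order `k + 1`, so the error in
`levi_inequality` is of higher order than the degree-`k` part of `∂∂̄r`. -/
theorem NormalFrame.levi_leading_part_nonneg (hF : NormalFrame r p t v ℓ w)
    (hr : IsDefiningFunction D V r) (hD : IsOpen D) (hpsc : IsLeviPseudoconvex D r)
    (hp : p ∈ frontier D) (hφ : VanishesToSecondOrder φ) {k : ℕ}
    (hk : ∀ i j, i + j < k + 2 → graphJet r p t v φ i j = 0) (z : ℂ) :
    0 ≤ (bipoly (fun i j => graphJet r p t v φ (i + 1) (j + 1)) (k + 1) z).re := by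
  have hcd := hr.contDiffAt (hr.frontier_subset hp)
  have hlow : ∀ i j, i + j < k → graphJet r p t v φ (i + 1) (j + 1) = 0 := fun i j hij =>
    hk _ _ (by omega)
  have hs := contDiffAt_along_graph (t := t) (v := v) hcd hφ
  obtain ⟨C, hC, hlevi⟩ := levi_inequality hr hD hpsc hp
    (hφ.graphCurve_differentiable (p := p) (t := t) (v := v)) hφ.graphCurve_zero
    (by rw [hφ.deriv_graphCurve]; exact hF.del_tangent)
  have hρ := isBigO_pow_of_le (by omega : k + 1 ≤ k + 2) (isBigO_of_jet_eq_zero hs hk)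
  have hwz := isBigO_of_jet_eq_zero (k := k + 1) (contDiffAt_wz hs) (fun i j hij => by
    rw [jet_wz hs]; exact hk _ _ (by omega))
  have hu := taylor_isBigO (k + 1) _ (contDiffAt_wz (contDiffAt_wzb hs))
  have hujet : jet (wz (wzb (fun z => (r (graphCurve p t v φ z) : ℂ)))) =
      fun i j => graphJet r p t v φ (i + 1) (j + 1) := by
    ext i j
    rw [jet_wz (contDiffAt_wzb hs), jet_wzb]
    rfl
  rw [hujet] at hu
  obtain ⟨C₁, h1⟩ := hρ.bound
  obtain ⟨C₂, h2⟩ := hwz.bound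
  obtain ⟨C₃, h3⟩ := hu.bound
  refine homogeneous_nonneg (k := k) (g := fun z => (bipoly (fun i j =>
    graphJet r p t v φ (i + 1) (j + 1)) (k + 1) z).re) (C := C * (C₁ + C₂) + C₃) ?_ ?_ z
  · intro s z
    rw [bipoly_smul hlow, ← Complex.ofReal_pow, Complex.re_ofReal_mul]
  · filter_upwards [hlevi, h1, h2, h3] with z l1 l2 l3 l4
    rw [Real.norm_of_nonneg (by positivity)] at l2 l3 l4
    rw [Complex.norm_real, Real.norm_eq_abs] at l2
    have l5 := (abs_le.1 ((Complex.abs_re_le_norm _).trans l4)).2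
    rw [Complex.sub_re] at l5
    have l6 := mul_le_mul_of_nonneg_left (add_le_add l2 l3) hC
    linarith

theorem eventually_norm_le_of_vanishes (hφ : VanishesToSecondOrder φ) :
    ∀ᶠ z in 𝓝 0, ‖φ z‖ ≤ ‖z‖ := by
  have h := (hasDerivAt_iff_isLittleO.1 (hφ.differentiable 0).hasDerivAt).bound one_pos
  filter_upwards [h] with z hz
  simpa [hφ.apply_zero, hφ.deriv_zero] using hz

/-- With the pure quadratic term removed, `r` on the graph is `b|z|²` plus cubic terms, so the peak
function meets the hypothesis of `orderOfContact_le_two`. -/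
theorem NormalFrame.dAngeloType_le_two (hF : NormalFrame r p t v ℓ w) (hr : ContDiffAt ℝ ∞ r p)
    (h0 : r p = 0) (hφ : VanishesToSecondOrder φ) (h20 : graphJet r p t v φ 2 0 = 0)
    (h11 : 0 < (graphJet r p t v φ 1 1).re) : dAngeloType r p ≤ 2 := by
  obtain ⟨h, hd, hp, hev⟩ := hF.exists_peak_function hr hφ one_pos
  set b := (graphJet r p t v φ 1 1).re with hb
  obtain ⟨C, hC⟩ := (taylor_isBigO 3 _ (contDiffAt_along_graph (t := t) (v := v) hr hφ)).bound
  have hz : Tendsto (fun x => ℓ (x - p)) (𝓝 p) (𝓝 0) := by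
    have hc : Continuous (fun x => ℓ (x - p)) := by fun_prop
    simpa using hc.tendsto p
  have hsmall : ∀ᶠ z in 𝓝 (0 : ℂ), C * ‖z‖ + ‖z‖ ^ 2 < b / 2 := by
    have hc : ContinuousAt (fun z : ℂ => C * ‖z‖ + ‖z‖ ^ 2) 0 := by fun_prop
    exact hc.eventually (gt_mem_nhds (by simpa using h11))
  -- `M` compares `‖x - p‖²` with `|z|² + |w - φ|²`. Half of `b` enters `c`; the other half absorbs
  -- the cubic remainder and the `|z|⁴` loss.
  set M : ℝ := 2 * (‖t‖ + ‖v‖) ^ 2 + 1 with hM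
  have hM0 : 0 < M := by positivity
  set c : ℝ := min (b / 2) 1 / M with hc
  have hmin : 0 < min (b / 2) 1 := lt_min (half_pos h11) one_pos
  have hc0 : 0 < c := div_pos hmin hM0
  refine iSup₂_le fun γ hγ => orderOfContact_le_two hd hp hc0 ?_ hγ
  filter_upwards [hev, hz.eventually hC, hz.eventually hsmall,
    hz.eventually (eventually_norm_le_of_vanishes hφ)] with x hx k1 k2 k3
  obtain ⟨κ, hκ, hle⟩ := hx
  refine ⟨κ, hκ, le_trans ?_ hle⟩
  set z := ℓ (x - p) with hzdef
  set y := w (x - p) - φ z with hydef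
  have hρ : b * ‖z‖ ^ 2 - C * ‖z‖ ^ 3 ≤ r (graphCurve p t v φ z) := by
    have hbi : (bipoly (graphJet r p t v φ) 3 z).re = b * ‖z‖ ^ 2 := by
      have h02 : graphJet r p t v φ 0 2 = 0 := by rw [graphJet_conj hr hφ, h20, map_zero]
      simp only [bipoly, Finset.sum_range_succ, Finset.range_zero, Finset.sum_empty,
        h20, h02, hF.graphJet_low hr h0 hφ (show 0 + 0 < 2 by norm_num),
        hF.graphJet_low hr h0 hφ (show 1 + 0 < 2 by norm_num),
        hF.graphJet_low hr h0 hφ (show 0 + 1 < 2 by norm_num), Nat.sub_zero, Nat.reduceSub]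
      simp only [zero_div, zero_mul, zero_add, add_zero, pow_one, Nat.factorial_one, Nat.cast_one,
        mul_one, div_one]
      rw [mul_assoc, Complex.mul_conj, Complex.re_mul_ofReal, Complex.normSq_eq_norm_sq]
    have := (abs_le.1 ((Complex.abs_re_le_norm _).trans k1)).1
    rw [Real.norm_of_nonneg (by positivity), Complex.sub_re, Complex.ofReal_re] at this
    change _ ≤ _ - (bipoly (graphJet r p t v φ) 3 z).re at this
    rw [hbi] at this
    linarith
  have hxn : ‖x - p‖ ^ 2 ≤ M * (‖z‖ ^ 2 + ‖y‖ ^ 2) := by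
    have e1 : ‖x - p‖ ≤ (‖t‖ + ‖v‖) * (‖z‖ + ‖y‖) := by
      have hw : ‖w (x - p)‖ ≤ ‖z‖ + ‖y‖ := by
        calc ‖w (x - p)‖ = ‖φ z + y‖ := by rw [hydef]; congr 1; ring
          _ ≤ ‖φ z‖ + ‖y‖ := norm_add_le _ _
          _ ≤ ‖z‖ + ‖y‖ := by gcongr
      calc ‖x - p‖ = ‖z • t + w (x - p) • v‖ := by rw [← hF.coord]
        _ ≤ ‖z‖ * ‖t‖ + ‖w (x - p)‖ * ‖v‖ := by
          refine (norm_add_le _ _).trans_eq ?_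
          rw [norm_smul, norm_smul]
        _ ≤ (‖z‖ + ‖y‖) * ‖t‖ + (‖z‖ + ‖y‖) * ‖v‖ := by
          gcongr
          exact le_add_of_nonneg_right (norm_nonneg _)
        _ = _ := by ring
    calc ‖x - p‖ ^ 2 ≤ ((‖t‖ + ‖v‖) * (‖z‖ + ‖y‖)) ^ 2 := by gcongr
      _ = (‖t‖ + ‖v‖) ^ 2 * (‖z‖ + ‖y‖) ^ 2 := by ring
      _ ≤ (‖t‖ + ‖v‖) ^ 2 * (2 * (‖z‖ ^ 2 + ‖y‖ ^ 2)) := by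
        gcongr
        exact add_sq_le
      _ ≤ M * (‖z‖ ^ 2 + ‖y‖ ^ 2) := by
        rw [hM]
        nlinarith [sq_nonneg ‖z‖, sq_nonneg ‖y‖]
  have hcx : c * ‖x - p‖ ^ 2 ≤ b / 2 * ‖z‖ ^ 2 + ‖y‖ ^ 2 := by
    have e1 : c * ‖x - p‖ ^ 2 ≤ c * (M * (‖z‖ ^ 2 + ‖y‖ ^ 2)) := by gcongr
    have e2 : c * (M * (‖z‖ ^ 2 + ‖y‖ ^ 2)) = min (b / 2) 1 * (‖z‖ ^ 2 + ‖y‖ ^ 2) := by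
      rw [hc]
      field_simp
    have e3 := mul_le_mul_of_nonneg_right (min_le_left (b / 2) 1) (sq_nonneg ‖z‖)
    have e4 := mul_le_mul_of_nonneg_right (min_le_right (b / 2) 1) (sq_nonneg ‖y‖)
    linarith
  have hk := mul_le_mul_of_nonneg_right k2.le (sq_nonneg ‖z‖)
  nlinarith

theorem norm_le_of_quadratic_nonneg {b : ℂ} {a : ℝ}
    (h : ∀ z : ℂ, 0 ≤ (b * z ^ 2).re + a * ‖z‖ ^ 2) : ‖b‖ ≤ a := by
  by_cases hb : b = 0
  · have := h 1
    simpa [hb] using this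
  · obtain ⟨z, hz⟩ := IsAlgClosed.exists_pow_nat_eq (-(starRingEnd ℂ) b) (n := 2) (by norm_num)
    have h1 := h z
    have h2 : ‖z‖ ^ 2 = ‖b‖ := by
      rw [← norm_pow, hz, norm_neg, RCLike.norm_conj]
    rw [hz, h2, mul_neg, Complex.mul_conj, Complex.normSq_eq_norm_sq, ← Complex.ofReal_neg,
      Complex.ofReal_re] at h1
    have hpos := norm_pos_iff.2 hb
    nlinarith

/-- A nonnegative quartic leading term becomes positive after adding a pure term `Re (q z⁴)`. -/
theorem quartic_lower_bound {b z : ℂ} {a : ℝ} (ha : 0 < a) (hb : ‖b‖ ≤ a) :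
    a / 72 * ‖z‖ ^ 4 ≤ (3 * b ^ 2 / (2 * a) * z ^ 4).re / 12 +
      (b * z ^ 3 * (starRingEnd ℂ) z).re / 3 + a / 4 * ‖z‖ ^ 4 := by
  set s := (b * z ^ 2).re with hs
  have hm : ‖z‖ ^ 4 = (‖z‖ ^ 2) ^ 2 := by ring
  have h1 : (b * z ^ 3 * (starRingEnd ℂ) z).re = s * ‖z‖ ^ 2 := by
    have : b * z ^ 3 * (starRingEnd ℂ) z = b * z ^ 2 * (‖z‖ ^ 2 : ℝ) := by
      rw [← Complex.normSq_eq_norm_sq, ← Complex.mul_conj]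
      ring
    rw [this, Complex.re_mul_ofReal]
  have h2 : (3 * b ^ 2 / (2 * a) * z ^ 4).re = 3 / (2 * a) * (2 * s ^ 2 - ‖b‖ ^ 2 * ‖z‖ ^ 4) := by
    have e1 : (3 : ℂ) * b ^ 2 / (2 * a) * z ^ 4 = ((3 / (2 * a) : ℝ) : ℂ) * (b * z ^ 2) ^ 2 := by
      push_cast
      ring
    have e2 : ((b * z ^ 2) ^ 2).re = 2 * s ^ 2 - ‖b * z ^ 2‖ ^ 2 := by
      rw [← Complex.normSq_eq_norm_sq, Complex.normSq_apply, pow_two (b * z ^ 2), Complex.mul_re]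
      ring
    rw [e1, Complex.re_ofReal_mul, e2, norm_mul, norm_pow]
    ring
  rw [h1, h2, hm]
  set m := ‖z‖ ^ 2 with hmdef
  have hbb : ‖b‖ ^ 2 * m ^ 2 ≤ a ^ 2 * m ^ 2 := by gcongr
  -- By `|b| ≤ a` the total is at least `s²/(4a) + sm/3 + am²/8`. Completing the square uses
  -- `am²/9`, and `1/8 - 1/9 = 1/72` is left.
  have key : 0 ≤ (3 * s + 2 * a * m) ^ 2 / (36 * a) := by positivity
  have e3 : (3 * s + 2 * a * m) ^ 2 / (36 * a) = s ^ 2 / (4 * a) + s * m / 3 + a * m ^ 2 / 9 := by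
    field_simp
    ring
  have e4 : 3 / (2 * a) * (2 * s ^ 2 - a ^ 2 * m ^ 2) / 12 = s ^ 2 / (4 * a) - a * m ^ 2 / 8 := by
    field_simp
    ring
  have e5 : 3 / (2 * a) * (2 * s ^ 2 - a ^ 2 * m ^ 2) ≤
      3 / (2 * a) * (2 * s ^ 2 - ‖b‖ ^ 2 * m ^ 2) := by gcongr
  linarith

end

end LeadingTerms

/-! ### Normalizing the graph to order four and constructing the peak function. -/

section LocalPeak

variable {n : ℕ} {D V : Set (Cn n)} {r : Cn n → ℝ} {p t v : Cn n} {ℓ w : Cn n →L[ℂ] ℂ} {φ : ℂ → ℂ}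

/-- Applying `exists_peak_function` with loss `ε/2` keeps half of the quartic bound, so `r ≤ 0`
forces `Re h < 0` off `p`. -/
theorem NormalFrame.isLocalPeakPoint (hF : NormalFrame r p t v ℓ w)
    (hr : IsDefiningFunction D V r) (hD : IsOpen D) (hp : p ∈ frontier D)
    (hφ : VanishesToSecondOrder φ) {ε : ℝ} (hε : 0 < ε)
    (hlow : ∀ᶠ z in 𝓝 0, ε * ‖z‖ ^ 4 ≤ r (graphCurve p t v φ z)) :
    IsLocalPeakPointAOmega D p := by
  have hpV := hr.frontier_subset hp
  obtain ⟨h, hd, h0, hev⟩ := hF.exists_peak_function (hr.contDiffAt hpV) hφ (half_pos hε)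
  have hz : Tendsto (fun x => ℓ (x - p)) (𝓝 p) (𝓝 0) := by
    have hc : Continuous (fun x => ℓ (x - p)) := by fun_prop
    simpa using hc.tendsto p
  obtain ⟨δ, hδ, hball⟩ := Metric.nhds_basis_closedBall.mem_iff.1
    (Filter.inter_mem hev (Filter.inter_mem (hz.eventually hlow) (hr.isOpen.mem_nhds hpV)))
  rw [hD.frontier_eq] at hp
  have hfr : p ∈ frontier (D ∩ Metric.ball p δ) := by
    rw [(hD.inter Metric.isOpen_ball).frontier_eq]
    refine ⟨?_, fun hcon => hp.2 hcon.1⟩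
    rw [Set.inter_comm]
    exact Metric.isOpen_ball.inter_closure ⟨Metric.mem_ball_self hδ, hp.1⟩
  refine ⟨by rwa [hD.frontier_eq], Metric.ball p δ, Metric.isOpen_ball, Metric.mem_ball_self hδ,
    hfr, fun x => Complex.exp (h x), ⟨Set.univ, isOpen_univ, Set.subset_univ _,
      hd.cexp.differentiableOn⟩, by simp [h0], ?_⟩
  rintro x ⟨hx, hxp⟩
  have hxD : x ∈ closure D := closure_mono Set.inter_subset_left hx
  have hxb : x ∈ Metric.closedBall p δ :=
    Metric.closure_ball_subset_closedBall (closure_mono Set.inter_subset_right hx)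
  obtain ⟨⟨κ, hκ, hle⟩, hlo, hxV⟩ := hball hxb
  have hlo : ε * ‖ℓ (x - p)‖ ^ 4 ≤ r (graphCurve p t v φ (ℓ (x - p))) := hlo
  have hrx := hr.nonpos_of_mem_closure hxV hxD
  have hpos : 0 < ε / 2 * ‖ℓ (x - p)‖ ^ 4 + ‖w (x - p) - φ (ℓ (x - p))‖ ^ 2 := by
    by_cases hℓ : ℓ (x - p) = 0
    · have hw : w (x - p) ≠ 0 := fun hw => hxp (by
        have := hF.coord (x - p)
        rw [hℓ, hw, zero_smul, zero_smul, add_zero] at this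
        exact sub_eq_zero.1 this)
      rw [hℓ, hφ.apply_zero, sub_zero]
      have := norm_pos_iff.2 hw
      positivity
    · have := norm_pos_iff.2 hℓ
      positivity
  have hneg : (h x).re < 0 := by
    by_contra! hcon
    have := mul_nonneg hκ.le hcon
    linarith
  rw [Complex.norm_exp]
  rwa [← Real.exp_zero, Real.exp_lt_exp]

theorem VanishesToSecondOrder.zero : VanishesToSecondOrder fun _ => 0 :=
  ⟨differentiable_const _, rfl, deriv_const _ _⟩

theorem NormalFrame.exists_jet_vanishing (hF : NormalFrame r p t v ℓ w)
    (hr : IsDefiningFunction D V r) (hD : IsOpen D) (hpsc : IsLeviPseudoconvex D r)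
    (hp : p ∈ frontier D) (htype : 2 < dAngeloType r p) :
    ∃ φ, VanishesToSecondOrder φ ∧ ∀ i j, i + j < 4 → graphJet r p t v φ i j = 0 := by
  have hcd := hr.contDiffAt (hr.frontier_subset hp)
  have hrp := hr.eq_zero_of_mem_frontier hD hp
  have h0 := VanishesToSecondOrder.zero
  let c₂ : ℂ := -graphJet r p t v (fun _ => 0) 2 0
  let φ₂ : ℂ → ℂ := fun z => 0 + c₂ * z ^ 2
  have hφ₂ : VanishesToSecondOrder φ₂ := h0.add_monomial c₂ le_rfl
  have h20 : graphJet r p t v φ₂ 2 0 = 0 := by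
    rw [hF.graphJet_add_monomial hcd h0 c₂ le_rfl (by norm_num)]
    simp [pureJet, c₂, Nat.factorial]
    ring
  have hlow₂ : ∀ i j, i + j < 2 → graphJet r p t v φ₂ i j = 0 := fun i j hij =>
    hF.graphJet_low hcd hrp hφ₂ hij
  have h11 : graphJet r p t v φ₂ 1 1 = 0 := by
    have hre : 0 ≤ (graphJet r p t v φ₂ 1 1).re := by
      have := hF.levi_leading_part_nonneg hr hD hpsc hp hφ₂ (k := 0) hlow₂ 0
      rwa [bipoly_apply_zero] at this
    have hre' : (graphJet r p t v φ₂ 1 1).re ≤ 0 := by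
      by_contra! hcon
      exact absurd (hF.dAngeloType_le_two hcd hrp hφ₂ h20 hcon) (not_le.2 htype)
    have him := Complex.conj_eq_iff_im.1 (graphJet_conj (t := t) (v := v) hcd hφ₂ 1 1).symm
    exact Complex.ext (le_antisymm hre' hre) him
  have hlow₃ : ∀ i j, i + j < 3 → graphJet r p t v φ₂ i j = 0 := by
    intro i j hij
    by_cases h : i + j < 2
    · exact hlow₂ i j h
    · obtain ⟨rfl, rfl⟩ | ⟨rfl, rfl⟩ | ⟨rfl, rfl⟩ : (i = 2 ∧ j = 0) ∨ (i = 1 ∧ j = 1) ∨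
        (i = 0 ∧ j = 2) := by omega
      · exact h20
      · exact h11
      · rw [graphJet_conj hcd hφ₂, h20, map_zero]
  have h21 : graphJet r p t v φ₂ 2 1 = 0 := by
    -- The leading part is now `2 Re (A z)` with `A` the jet `(2,1)`; at `z = -Ā` it equals
    -- `-2|A|²`.
    have hlin := hF.levi_leading_part_nonneg hr hD hpsc hp hφ₂ (k := 1) hlow₃
      (-(starRingEnd ℂ) (graphJet r p t v φ₂ 2 1))
    have h12 := graphJet_conj (t := t) (v := v) hcd hφ₂ 1 2
    simp only [bipoly, Finset.sum_range_succ, Finset.range_zero, Finset.sum_empty, h11, h12,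
      Nat.sub_zero, Nat.reduceSub, Nat.reduceAdd] at hlin
    simp [-map_neg] at hlin
    have hre : (graphJet r p t v φ₂ 2 1).re ^ 2 ≤ 0 := by
      nlinarith [sq_nonneg (graphJet r p t v φ₂ 2 1).im]
    have him : (graphJet r p t v φ₂ 2 1).im ^ 2 ≤ 0 := by
      nlinarith [sq_nonneg (graphJet r p t v φ₂ 2 1).re]
    exact Complex.ext (pow_eq_zero_iff two_ne_zero |>.1 (le_antisymm hre (sq_nonneg _)))
      (pow_eq_zero_iff two_ne_zero |>.1 (le_antisymm him (sq_nonneg _)))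
  -- `Re (c z³)` has jet `3! c / 2 = 3c` at `(3,0)`; the divisor 12 at order four arises in the same
  -- way.
  let c₃ : ℂ := -graphJet r p t v φ₂ 3 0 / 3
  let φ₃ : ℂ → ℂ := fun z => φ₂ z + c₃ * z ^ 3
  have hφ₃ : VanishesToSecondOrder φ₃ := hφ₂.add_monomial c₃ (by norm_num)
  have hadd (i j : ℕ) (hij : i + j ≤ 3) :
      graphJet r p t v φ₃ i j = graphJet r p t v φ₂ i j + pureJet c₃ 3 i j :=
    hF.graphJet_add_monomial hcd hφ₂ c₃ (by norm_num) hij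
  have h30 : graphJet r p t v φ₃ 3 0 = 0 := by
    rw [hadd 3 0 (by norm_num)]
    simp [pureJet, c₃, Nat.factorial]
    ring
  refine ⟨φ₃, hφ₃, fun i j hij => ?_⟩
  by_cases h : i + j < 3
  · rw [hadd i j (by omega), hlow₃ i j h, pureJet, if_neg (by omega), if_neg (by omega), add_zero]
  · obtain ⟨rfl, rfl⟩ | ⟨rfl, rfl⟩ | ⟨rfl, rfl⟩ | ⟨rfl, rfl⟩ : (i = 3 ∧ j = 0) ∨ (i = 2 ∧ j = 1) ∨
      (i = 1 ∧ j = 2) ∨ (i = 0 ∧ j = 3) := by omega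
    · exact h30
    · rw [hadd 2 1 (by norm_num), h21]
      simp [pureJet]
    · rw [graphJet_conj hcd hφ₃, hadd 2 1 (by norm_num), h21]
      simp [pureJet]
    · rw [graphJet_conj hcd hφ₃, h30, map_zero]

theorem bipoly_five_re {c : ℕ → ℕ → ℂ} (h0 : ∀ i j, i + j < 4 → c i j = 0)
    (hc : ∀ i j, c i j = (starRingEnd ℂ) (c j i)) (z : ℂ) :
    (bipoly c 5 z).re = (c 4 0 * z ^ 4).re / 12 + (c 3 1 * z ^ 3 * (starRingEnd ℂ) z).re / 3 +
      (c 2 2).re / 4 * ‖z‖ ^ 4 := by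
  have h22 : c 2 2 = ((c 2 2).re : ℂ) := (Complex.conj_eq_iff_re.1 (hc 2 2).symm).symm
  have e : bipoly c 5 z = (c 4 0 * z ^ 4) / 24 + (starRingEnd ℂ) (c 4 0 * z ^ 4) / 24 +
      (c 3 1 * z ^ 3 * (starRingEnd ℂ) z) / 6 +
      (starRingEnd ℂ) (c 3 1 * z ^ 3 * (starRingEnd ℂ) z) / 6 +
      (((c 2 2).re / 4 * ‖z‖ ^ 4 : ℝ) : ℂ) := by
    have hn : ((‖z‖ ^ 4 : ℝ) : ℂ) = (z * (starRingEnd ℂ) z) ^ 2 := by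
      rw [Complex.mul_conj, Complex.normSq_eq_norm_sq]
      push_cast
      ring
    rw [bipoly_succ, bipoly_eq_zero h0, zero_add, Complex.ofReal_mul, hn, Complex.ofReal_div, ← h22]
    simp only [Finset.sum_range_succ, Finset.range_zero, Finset.sum_empty, Nat.sub_zero,
      Nat.reduceSub, hc 0 4, hc 1 3, map_mul, map_pow, Complex.conj_conj]
    norm_num [Nat.factorial]
    ring
  rw [e]
  simp only [Complex.add_re, Complex.ofReal_re]
  have h24 (x : ℂ) : (x / 24).re = x.re / 24 := by
    simp
  have h6 (x : ℂ) : (x / 6).re = x.re / 6 := by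
    simp
  rw [h24, h24, h6, h6, Complex.conj_re, Complex.conj_re]
  ring

theorem NormalFrame.exists_quartic_lower_bound (hF : NormalFrame r p t v ℓ w)
    (hr : IsDefiningFunction D V r) (hD : IsOpen D) (hpsc : IsLeviPseudoconvex D r)
    (hp : p ∈ frontier D) (htype : dAngeloType r p < 5) (hφ : VanishesToSecondOrder φ)
    (hjet : ∀ i j, i + j < 4 → graphJet r p t v φ i j = 0) :
    ∃ φ', VanishesToSecondOrder φ' ∧ ∃ ε : ℝ, 0 < ε ∧
      ∀ᶠ z in 𝓝 0, ε * ‖z‖ ^ 4 ≤ r (graphCurve p t v φ' z) := by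
  have hcd := hr.contDiffAt (hr.frontier_subset hp)
  have hconj := graphJet_conj (t := t) (v := v) hcd hφ
  set a := (graphJet r p t v φ 2 2).re with ha
  set b := graphJet r p t v φ 3 1 with hb
  have h22 : graphJet r p t v φ 2 2 = (a : ℂ) := (Complex.conj_eq_iff_re.1 (hconj 2 2).symm).symm
  have hba : ‖b‖ ≤ a := by
    refine norm_le_of_quadratic_nonneg fun z => ?_
    have h := hF.levi_leading_part_nonneg hr hD hpsc hp hφ (k := 2) hjet z
    have e : bipoly (fun i j => graphJet r p t v φ (i + 1) (j + 1)) 3 z =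
        b * z ^ 2 / 2 + (starRingEnd ℂ) (b * z ^ 2) / 2 + ((a * ‖z‖ ^ 2 : ℝ) : ℂ) := by
      have hn : ((‖z‖ ^ 2 : ℝ) : ℂ) = z * (starRingEnd ℂ) z := by
        rw [Complex.mul_conj, Complex.normSq_eq_norm_sq]
      rw [bipoly_succ, bipoly_eq_zero (fun i j hij => hjet _ _ (by omega)), zero_add,
        Complex.ofReal_mul, hn, ← h22]
      simp only [Finset.sum_range_succ, Finset.range_zero, Finset.sum_empty, Nat.sub_zero,
        Nat.reduceSub, Nat.reduceAdd, hconj 1 3, map_mul, map_pow, hb]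
      norm_num [Nat.factorial]
      ring
    have h2 (x : ℂ) : (x / 2).re = x.re / 2 := by
      simp
    rw [e, Complex.add_re, Complex.add_re, Complex.ofReal_re, h2, h2, Complex.conj_re] at h
    linarith
  have hmod (q : ℂ) : ∃ φ', VanishesToSecondOrder φ' ∧
      (∀ i j, i + j < 4 → graphJet r p t v φ' i j = 0) ∧ graphJet r p t v φ' 4 0 = q ∧
      graphJet r p t v φ' 3 1 = b ∧ graphJet r p t v φ' 2 2 = a := by
    let c : ℂ := (q - graphJet r p t v φ 4 0) / 12
    have hadd {i j : ℕ} (hij : i + j ≤ 4) :=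
      hF.graphJet_add_monomial hcd hφ c (k := 4) (by norm_num) hij
    refine ⟨fun z => φ z + c * z ^ 4, hφ.add_monomial c (by norm_num), fun i j hij => ?_, ?_, ?_, ?_⟩
    · rw [hadd (by omega), hjet i j hij, pureJet, if_neg (by omega), if_neg (by omega), add_zero]
    · rw [hadd (by norm_num)]
      simp [pureJet, c, Nat.factorial]
      ring
    · rw [hadd (by norm_num)]
      simp [pureJet, hb]
    · rw [hadd (by norm_num), h22]
      simp [pureJet]
  -- Otherwise `a = b = 0`, and with the pure quartic term removed the graph has contact at least 5.
  have ha0 : 0 < a := by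
    by_contra! hle
    have hb0 : b = 0 := norm_le_zero_iff.1 (hba.trans hle)
    have haz : a = 0 := le_antisymm hle ((norm_nonneg b).trans hba)
    obtain ⟨φ', hφ', hlow, h40, h31, h22'⟩ := hmod 0
    rw [hb0] at h31
    rw [haz, Complex.ofReal_zero] at h22'
    have hconj' := graphJet_conj (t := t) (v := v) hcd hφ'
    have hO := isBigO_of_jet_eq_zero (k := 5) (contDiffAt_along_graph (t := t) (v := v) hcd hφ')
      (fun i j hij => by
        change graphJet r p t v φ' i j = 0
        by_cases h : i + j < 4
        · exact hlow i j h
        · obtain ⟨rfl, rfl⟩ | ⟨rfl, rfl⟩ | ⟨rfl, rfl⟩ | ⟨rfl, rfl⟩ | ⟨rfl, rfl⟩ :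
            (i = 4 ∧ j = 0) ∨ (i = 3 ∧ j = 1) ∨ (i = 2 ∧ j = 2) ∨ (i = 1 ∧ j = 3) ∨
            (i = 0 ∧ j = 4) := by omega
          · exact h40
          · exact h31
          · exact h22'
          · rw [hconj', h31, map_zero]
          · rw [hconj', h40, map_zero])
    have hO' : (fun z => r (graphCurve p t v φ' z)) =O[𝓝 0] fun z : ℂ => ‖z‖ ^ 5 :=
      (IsBigO.of_norm_left (hO.norm_left.congr_left fun z => Complex.norm_real _))
    have h5 := le_dAngeloType_of_regular_curve hφ'.graphCurve_differentiable hφ'.graphCurve_zero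
      (by rw [hφ'.deriv_graphCurve]; exact hF.tangent_ne_zero) hO'
    exact absurd htype (not_lt.2 (by simpa using h5))
  -- The pure jet required by `quartic_lower_bound`; of its bound `a / 72`, half is spent on the
  -- Taylor remainder.
  obtain ⟨φ', hφ', hlow, h40, h31, h22'⟩ := hmod (3 * b ^ 2 / (2 * a))
  refine ⟨φ', hφ', a / 144, by positivity, ?_⟩
  obtain ⟨C, hC⟩ := (taylor_isBigO 5 _ (contDiffAt_along_graph (t := t) (v := v) hcd hφ')).bound
  have hsmall : ∀ᶠ z in 𝓝 (0 : ℂ), C * ‖z‖ < a / 144 := by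
    have hc : ContinuousAt (fun z : ℂ => C * ‖z‖) 0 := by fun_prop
    exact hc.eventually (gt_mem_nhds (by simpa using ha0))
  filter_upwards [hC, hsmall] with z h1 h2
  have h3 := (abs_le.1 ((Complex.abs_re_le_norm _).trans h1)).1
  rw [Real.norm_of_nonneg (by positivity), Complex.sub_re, Complex.ofReal_re] at h3
  change _ ≤ _ - (bipoly (graphJet r p t v φ') 5 z).re at h3
  rw [bipoly_five_re hlow (graphJet_conj hcd hφ'), h40, h31, h22', Complex.ofReal_re] at h3
  have h4 := quartic_lower_bound (z := z) ha0 hba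
  have h5 := mul_le_mul_of_nonneg_right h2.le (pow_nonneg (norm_nonneg z) 4)
  rw [pow_succ] at h3
  linarith

end LocalPeak

end SCV

theorem proposition3p1 (D V : Set (SCV.Cn 2)) (r : SCV.Cn 2 → ℝ) (p : SCV.Cn 2)
    (hopen : IsOpen D) (hconn : IsConnected D) (hbdd : Bornology.IsBounded D)
    (hr : SCV.IsDefiningFunction D V r) (hpsc : SCV.IsLeviPseudoconvex D r)
    (hp : p ∈ frontier D) (htype : SCV.dAngeloType r p = 4) :
    SCV.IsLocalPeakPointAOmega D p := by
  have hpV := hr.frontier_subset hp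
  obtain ⟨t, v, ℓ, w, hF⟩ := SCV.exists_normalFrame
    ((hr.contDiffAt hpV).differentiableAt (by simp)) (hr.gradient_ne_zero p hpV)
  obtain ⟨φ, hφ, hjet⟩ := hF.exists_jet_vanishing hr hopen hpsc hp
    (by rw [htype]; norm_num)
  obtain ⟨φ', hφ', ε, hε, hlow⟩ := hF.exists_quartic_lower_bound hr hopen hpsc hp
    (by rw [htype]; norm_num) hφ hjet
  exact hF.isLocalPeakPoint hr hopen hp hφ' hε hlow
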